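/- \textbf{Setting.} Consider a delay differential-algebraic equation (DDAE) $F(t,x,\dot x,\Delta_{-\tau}x)=0$ with $\tau>0$, $M$ equations $F_1,\dots,F_M$ and unknown $x=(x_1,\dots,x_n)$, where $(\Delta_{k\tau}x)(t)=x(t+k\tau)$; it is known which of the variables $x_i,\dot x_i,\Delta_{-\tau}x_i$ appear in which equation. The \emph{graph of the DDAE} is the bipartite graph whose vertices are the equations and the variables that appear, with an edge $\{v,F_j\}$ if $v$ appears in $F_j$. Let $R_{\mathrm{equal}}$ identify two variables that differ only by differentiations and shifts, and let $\overline\Theta$ be the set of those components of $x$ and $\dot x$ that appear in $F$. The DDAE is \emph{structurally nonsingular with respect to} $\overline\Theta/R_{\mathrm{equal}}$ if for every subset $S$ of the equations, $|S|$ is at most the number of classes of $R_{\mathrm{equal}}$ on the set of variables from $\overline\Theta$ that appear in the equations of $S$. \textbf{Pantelides algorithm for DAEs.} Start from the graph of a DAE $F(t,x,\dot x)=0$ and the empty matching. For $r=1,\dots,M$ repeat the following until the search succeeds: delete temporarily every variable $x_i^{(k)}$ for which some $x_i^{(k+s)}$, $s>0$, is a vertex; search depth first for an augmenting path that starts in the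 $r$-th equation. If there is one, augment the matching. Otherwise replace every equation visited by its derivative (a differentiated equation keeps its variables, and for each variable $x_i^{(k)}$ in it also contains $x_i^{(k+1)}$), add $x_i^{(k+1)}$ for each visited $x_i^{(k)}$, and let $x_i^{(k+1)}$ take over the matching edge of $x_i^{(k)}$. The output is the final graph. \textbf{Pantelides algorithm for DDAEs.} (1) \emph{Shifting step}: run the same procedure on the shifting graph, in which variables that differ only by their order of differentiation are merged, with shifts in place of derivatives (a shifted equation contains exactly the shifted variables; a variable $\Delta_{-\tau}x_i^{(p)}$ is never a highest shift and is always deleted temporarily). Whenever the search fails, the visited equations are first differentiated in the full graph as often as given by the maximum, over all connections, of the solutions of the associated linear integer programs. Here a connection is a connected set of alternating paths $(F_a,v,F_b)$ between visited equations, with $\{v,F_b\}$ a matching edge and $\{F_a,v\}$ not, in which every matched visited equation occurs exactly once as $F_b$; its program is to minimize the total number $\sum_a\nu_a$ of differentiations, $\nu_a\in\mathbb N_0$, subject to $\nu_a-\nu_b=d(F_b,v)-d(F_a,v)$ for all its paths, where $d(F,v)$ is the highest order of differentiation with which a member of the class $v$ appears in $F$. (2) \emph{Trimmed linearization}: if a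 component $x_i$ occurs with derivatives of order up to $q_i\ge2$, replace $x_i^{(p)}$, $1\le p<q_i$, by new components $y_{i,p}$, replace $x_i^{(q_i)}$ by $\dot y_{i,q_i-1}$, and add the equations $\dot y_{i,p-1}=y_{i,p}$, $1\le p<q_i$, $y_{i,0}=x_i$, each shifted by the largest shift with which a derivative of $x_i$ of order $\ge p$ appears. (3) \emph{Differentiation step}: run the procedure for DAEs on the differentiation graph, in which delayed variables are omitted and variables that differ only by a shift are merged, performing each differentiation also in the full graph. The output is the final full graph $G$. \textbf{Theorem.} Suppose that the DDAE is structurally nonsingular with respect to $\overline\Theta/R_{\mathrm{equal}}$. Then, in whatever order the searches visit the neighbours of an equation, the Pantelides algorithm for DDAEs, applied to the graph of the DDAE, terminates, and no equation is shifted: its output $G$ has the $M$ equations $F_1^{(\ell_1)},\dots,F_M^{(\ell_M)}$, all unshifted. Moreover, for every function parameter $\lambda$, the Pantelides algorithm for DAEs, applied to the graph of the DAE $F(t,x,\dot x,\lambda(t))=0$ obtained by replacing $\Delta_{-\tau}x$ with $\lambda$ (so that delayed variables are not vertices), terminates as well, and its output $H$ is isomorphic to the graph obtained from $G$ by deleting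 the delayed variables. There is an isomorphism that preserves names: it maps $F_j^{(\ell_j)}$ to $F_j^{(\ell_j)}$ and $x_i^{(k)}$ to $x_i^{(k)}$. -/

import Mathlib

namespace Pantelides

/-! ## Names, bipartite graphs and structural nonsingularity -/

/-- The name of the variable obtained from the component `x_idx` by differentiating `der` times and
shifting by `shift * τ`. Components are numbered `0, 1, 2, …`. -/
structure VarName where
  idx : ℕ
  der : ℕ
  shift : ℤ
  deriving DecidableEq

/-- How often an equation has been differentiated and shifted. -/
structure EqLabel where
  der : ℕ
  shift : ℕ

/-- A bipartite graph. The equation vertices are `F_0, …, F_{M-1}`; as equations are replaced, never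
added, when they are differentiated or shifted, the vertex `F_j` carries a label which records the
differentiations and shifts performed so far. The variable vertices are `vars`, and `(v, j) ∈ edges`
means that there is an edge between the variable `v` and the equation `F_j`. The number `n` is the
number of components of the unknown (used only for choosing fresh names). -/
structure BGraph (V L : Type) where
  M : ℕ
  n : ℕ
  label : ℕ → L
  vars : Finset V
  edges : Finset (V × ℕ)

/-- An isomorphism of bipartite graphs. -/
structure BGraph.Iso {V L V' L' : Type} (G : BGraph V L) (H : BGraph V' L') where
  onEq : {j : ℕ // j < G.M} ≃ {j : ℕ // j < H.M}
  onVar : {v : V // v ∈ G.vars} ≃ {v : V' // v ∈ H.vars}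
  edge_iff : ∀ (v : {v : V // v ∈ G.vars}) (j : {j : ℕ // j < G.M}),
    (v.1, j.1) ∈ G.edges ↔ ((onVar v).1, (onEq j).1) ∈ H.edges

/-- The number of classes of the equivalence relation `R`, restricted to the set `A`. -/
noncomputable def numClasses (A : Finset VarName) (R : Setoid VarName) : ℕ :=
  Nat.card (Quotient (R.comap (Subtype.val : {v : VarName // v ∈ A} → VarName)))

/-- A system of `M` equations, where `appearing j` is the set of variables that appear in the `j`-th
equation, is structurally singular with respect to `Θ / R` if some subset `S` of the equations has
more elements than there are classes of `R` on the variables from `Θ` that appear in `S`. -/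
def StructurallySingular {M : ℕ} (appearing : Fin M → Finset VarName)
    (Θ : Finset VarName) (R : Setoid VarName) : Prop :=
  ∃ S : Finset (Fin M), numClasses (Θ ∩ S.biUnion appearing) R < S.card

/-- Two variables are equivalent if they differ only by differentiations and shifts. -/
def REqual : Setoid VarName where
  r v w := ∃ (i p q : ℕ) (k l : ℤ), v = ⟨i, p, k⟩ ∧ w = ⟨i, q, l⟩
  iseqv :=
    { refl := fun v => ⟨v.idx, v.der, v.der, v.shift, v.shift, rfl, rfl⟩
      symm := by
        rintro v w ⟨i, p, q, k, l, rfl, rfl⟩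
        exact ⟨i, q, p, l, k, rfl, rfl⟩
      trans := by
        rintro u v w ⟨i, p, q, k, l, rfl, rfl⟩ ⟨i', p', q', k', l', h, rfl⟩
        cases h
        exact ⟨i, p, q', k, l', rfl, rfl⟩ }

/-! ## Delay differential-algebraic equations -/

/-- A delay differential-algebraic equation `F(t, x(t), x'(t), x(t - τ)) = 0` of `M` equations in `n`
unknown functions. That a variable appears in an equation is syntactic information, which is not
determined by the function `F` (a variable may appear although the value of `F` does not depend on
it). It is therefore part of the data: `occX j`, `occDx j`, `occDelay j` are the indices `i` for which
`x_i`, `x_i'`, `x_i(t - τ)`, respectively, appears in the `j`-th equation, and the value of the `j`-th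
equation is determined by the variables that appear in it. -/
structure DDAE (M n : ℕ) where
  τ : ℝ
  τ_pos : 0 < τ
  dom : Set (ℝ × (Fin n → ℝ) × (Fin n → ℝ) × (Fin n → ℝ))
  F : ℝ → (Fin n → ℝ) → (Fin n → ℝ) → (Fin n → ℝ) → Fin M → ℝ
  occX : Fin M → Finset (Fin n)
  occDx : Fin M → Finset (Fin n)
  occDelay : Fin M → Finset (Fin n)
  determined : ∀ (j : Fin M) (t : ℝ) (x x' y y' z z' : Fin n → ℝ),
    (t, x, y, z) ∈ dom → (t, x', y', z') ∈ dom →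
    (∀ i ∈ occX j, x i = x' i) → (∀ i ∈ occDx j, y i = y' i) → (∀ i ∈ occDelay j, z i = z' i) →
    F t x y z j = F t x' y' z' j

/-- A differential-algebraic equation `F(t, x(t), x'(t)) = 0`, with the same conventions. -/
structure DAE (M n : ℕ) where
  dom : Set (ℝ × (Fin n → ℝ) × (Fin n → ℝ))
  F : ℝ → (Fin n → ℝ) → (Fin n → ℝ) → Fin M → ℝ
  occX : Fin M → Finset (Fin n)
  occDx : Fin M → Finset (Fin n)
  determined : ∀ (j : Fin M) (t : ℝ) (x x' y y' : Fin n → ℝ),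
    (t, x, y) ∈ dom → (t, x', y') ∈ dom →
    (∀ i ∈ occX j, x i = x' i) → (∀ i ∈ occDx j, y i = y' i) →
    F t x y j = F t x' y' j

namespace DDAE

variable {M n : ℕ}

/-- The differential-algebraic equation `F(t, x(t), x'(t), lam(t)) = 0` in which the delayed variable
is replaced by a function parameter `lam`. -/
def withParameter (D : DDAE M n) (lam : ℝ → Fin n → ℝ) : DAE M n where
  dom := {p | (p.1, p.2.1, p.2.2, lam p.1) ∈ D.dom}
  F t x y := D.F t x y (lam t)
  occX := D.occX
  occDx := D.occDx
  determined := fun j t x x' y y' h h' hx hy =>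
    D.determined j t x x' y y' (lam t) (lam t) h h' hx hy (fun _ _ => rfl)

/-- The variables that appear in the `j`-th equation. -/
def appearing (D : DDAE M n) (j : Fin M) : Finset VarName :=
  (D.occX j).image (fun i : Fin n => ⟨i, 0, 0⟩) ∪ (D.occDx j).image (fun i : Fin n => ⟨i, 1, 0⟩) ∪
    (D.occDelay j).image (fun i : Fin n => ⟨i, 0, -1⟩)

/-- The set of variables of the equation. -/
def allVariables (D : DDAE M n) : Finset VarName :=
  Finset.univ.biUnion D.appearing

/-- The variables among the components of `x` and `x'` that appear in the equation. -/
def nonDelayedVariables (D : DDAE M n) : Finset VarName :=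
  D.allVariables.filter (fun v => v.shift = 0)

/-- The graph of the delay differential-algebraic equation (over the trivial equivalence relation). -/
def graph (D : DDAE M n) : BGraph VarName EqLabel where
  M := M
  n := n
  label _ := ⟨0, 0⟩
  vars := D.allVariables
  edges := Finset.univ.biUnion fun j => (D.appearing j).image fun v => (v, (j : ℕ))

end DDAE

/-- The vertex `(i, k)` stands for `x_{i,k}`, where `k` is an order of differentiation or a shift,
depending on the type of the graph. -/
abbrev LVar := ℕ × ℤ

/-- A graph with vertices `x_{i,k}` and `F_{j,l}`, the level `l` of `F_j` being its label. -/
abbrev LGraph := BGraph LVar ℕ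

/-- The graph of a differential-algebraic equation: `(i, k)` is the variable `x_i^{(k)}`. -/
def DAE.graph {M n : ℕ} (A : DAE M n) : LGraph where
  M := M
  n := n
  label _ := 0
  vars := Finset.univ.biUnion fun j =>
    (A.occX j).image (fun i : Fin n => ((i : ℕ), (0 : ℤ))) ∪ (A.occDx j).image (fun i : Fin n => ((i : ℕ), (1 : ℤ)))
  edges := Finset.univ.biUnion fun j =>
    (A.occX j).image (fun i : Fin n => (((i : ℕ), (0 : ℤ)), (j : ℕ))) ∪
      (A.occDx j).image (fun i : Fin n => (((i : ℕ), (1 : ℤ)), (j : ℕ)))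

/-- Delete the delayed variables, with all edges at them. -/
def deleteDelayed (G : BGraph VarName EqLabel) : BGraph VarName EqLabel :=
  { G with
    vars := G.vars.filter (fun v => 0 ≤ v.shift)
    edges := G.edges.filter (fun e => 0 ≤ e.1.shift) }

/-- The shifting graph: variables that differ only by their order of differentiation are merged. -/
def shiftingGraph (G : BGraph VarName EqLabel) : LGraph where
  M := G.M
  n := G.n
  label j := (G.label j).shift
  vars := G.vars.image fun v => (v.idx, v.shift)
  edges := G.edges.image fun e => ((e.1.idx, e.1.shift), e.2)

/-- The differentiation graph: delayed variables are excluded, and the remaining variables are merged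
if they differ only by their shift. -/
def differentiationGraph (G : BGraph VarName EqLabel) : LGraph where
  M := G.M
  n := G.n
  label j := (G.label j).der
  vars := (deleteDelayed G).vars.image fun v => (v.idx, (v.der : ℤ))
  edges := (deleteDelayed G).edges.image fun e => ((e.1.idx, (e.1.der : ℤ)), e.2)

/-! ## Search for an augmenting path

The algorithms below may run forever. Each of them is a program with an additional argument `N`, a bound
on the number of nested recursive calls and on the number of passes through each `repeat` loop. The value
is `none` if this bound is exceeded; otherwise it is `some r`, where `r` is the result of the algorithm,
which does not depend on `N`. Thus the algorithm terminates with the result `r` if the value is `some r`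
for some `N`. -/

/-- An order in which the variables adjacent to an equation are visited: `σ j s` lists the finite
set `s` of variables when the search is at the equation `F_j`. -/
def IsEnumeration (σ : ℕ → Finset LVar → List LVar) : Prop :=
  ∀ j s, (σ j s).Nodup ∧ ∀ v, v ∈ σ j s ↔ v ∈ s

/-- The state of the search: the matching (`assign v = some j` if `v` is matched with `F_j`, and
`none` if `v` is exposed), and the sets of coloured variables and equations. -/
structure SearchState where
  assign : LVar → Option ℕ
  colorV : Finset LVar
  colorE : Finset ℕ

/-- The variables adjacent to `F_j`. -/
def neighbours (H : LGraph) (j : ℕ) : Finset LVar :=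
  H.vars.filter fun v => (v, j) ∈ H.edges

/-- The loop over the list of variables adjacent to `F_j`, in the search for an augmenting path. The
Boolean in the result says whether an augmenting path has been found. -/
def augmentLoop (σ : ℕ → Finset LVar → List LVar) (H : LGraph) :
    ℕ → ℕ → List LVar → SearchState → Option (Bool × SearchState)
  | _, _, [], s => some (false, s)
  | 0, _, _ :: _, _ => none
  | N + 1, j, v :: l, s =>
    if v ∈ s.colorV then augmentLoop σ H N j l s
    else
      match s.assign v with
      | none =>
        some (true, { s with
          colorV := insert v s.colorV
          assign := Function.update s.assign v (some j) })
      | some k =>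
        (augmentLoop σ H N k (σ k (neighbours H k))
          { s with colorV := insert v s.colorV, colorE := insert k s.colorE }).bind fun r =>
        if r.1 then
          some (true, { r.2 with assign := Function.update r.2.assign v (some j) })
        else augmentLoop σ H N j l r.2

/-- Depth-first search for an augmenting path in `H` that starts in `F_j`. -/
def augmentPath (σ : ℕ → Finset LVar → List LVar) (H : LGraph) (N j : ℕ) (s : SearchState) :
    Option (Bool × SearchState) :=
  augmentLoop σ H N j (σ j (neighbours H j)) { s with colorE := insert j s.colorE }

/-- `x_{i,k}` is a highest derivative (or highest shift) among `V`: no `x_{i,k+s}` with `s > 0` is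
in `V`, and `k` is nonnegative (a delayed variable is never a highest shift). -/
def IsHighest (V : Finset LVar) (v : LVar) : Prop :=
  0 ≤ v.2 ∧ ∀ w ∈ V, w.1 = v.1 → w.2 ≤ v.2

instance (V : Finset LVar) : DecidablePred (IsHighest V) := fun v => by
  unfold IsHighest
  infer_instance

/-- Delete all variables that are not highest derivatives (or highest shifts). -/
def restrictHighest (G : LGraph) : LGraph :=
  { G with
    vars := G.vars.filter (IsHighest G.vars)
    edges := G.edges.filter fun e => IsHighest G.vars e.1 }

/-- After a differentiation or shift, `x_{i,k+1}` takes over the matching edge of every coloured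
`x_{i,k}`. -/
def raiseAssign (assign : LVar → Option ℕ) (colorV : Finset LVar) : LVar → Option ℕ :=
  fun v => if (v.1, v.2 - 1) ∈ colorV ∧ (assign (v.1, v.2 - 1)).isSome
    then assign (v.1, v.2 - 1) else assign v

/-! ## The Pantelides algorithm for differential-algebraic equations -/

/-- Differentiate the coloured equations, in the graph of a differential-algebraic equation. -/
def daeUpdate (G : LGraph) (s : SearchState) : LGraph :=
  { G with
    label := fun j => if j ∈ s.colorE then G.label j + 1 else G.label j
    vars := G.vars ∪ (G.vars.filter (· ∈ s.colorV)).image fun v => (v.1, v.2 + 1)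
    edges := G.edges ∪ (G.edges.filter (fun e => e.2 ∈ s.colorE)).image
      fun e => ((e.1.1, e.1.2 + 1), e.2) }

/-- The inner loop, for the equation `F_r`: differentiate until an augmenting path is found. -/
def daeRepeat (σ : ℕ → Finset LVar → List LVar) (r : ℕ) :
    ℕ → (LVar → Option ℕ) → LGraph → Option ((LVar → Option ℕ) × LGraph)
  | 0, _, _ => none
  | N + 1, assign, G =>
    (augmentPath σ (restrictHighest G) N r ⟨assign, ∅, ∅⟩).bind fun p =>
    if p.1 then some (p.2.assign, G)
    else daeRepeat σ r N (raiseAssign p.2.assign p.2.colorV) (daeUpdate G p.2)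

/-- The Pantelides algorithm for differential-algebraic equations. -/
def pantelidesDAE (σ : ℕ → Finset LVar → List LVar) (N : ℕ) (G : LGraph) : Option LGraph :=
  ((List.range G.M).foldlM (fun st r => daeRepeat σ r N st.1 st.2)
    ((fun _ => none : LVar → Option ℕ), G)).map Prod.snd

/-! ## The Pantelides algorithm for delay differential-algebraic equations -/

/-- The two operations on equations. -/
inductive Op where
  | shift
  | dif

/-- Shift or differentiate equations in a graph: `colorE j` is the number of times the operation is
applied to `F_j`, `colorV v` the number of higher levels of `v` that are added to the variables, and
`up q v` is the variable `v` after `q` operations. A shifted equation contains exactly the shifted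
variables, a differentiated equation contains in addition to its variables all their derivatives up to
the corresponding order. -/
def updateGraph {V L : Type} [DecidableEq V] (op : Op) (up : ℕ → V → V) (upL : ℕ → L → L)
    (colorV : V → ℕ) (colorE : ℕ → ℕ) (G : BGraph V L) : BGraph V L :=
  let E : Finset (V × ℕ) := match op with
    | Op.shift => G.edges.image fun e => (up (colorE e.2) e.1, e.2)
    | Op.dif => G.edges ∪ G.edges.biUnion fun e =>
        (Finset.Icc 1 (colorE e.2)).image fun p => (up p e.1, e.2)
  { G with
    label := fun j => upL (colorE j) (G.label j)
    vars := G.vars ∪ (G.vars.biUnion fun v => (Finset.Icc 1 (colorV v)).image fun p => up p v) ∪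
      E.image Prod.fst
    edges := E }

/-- Raise the level of `x_{i,k}`. -/
def LVar.up (q : ℕ) (v : LVar) : LVar := (v.1, v.2 + q)

/-- Shift or differentiate a variable `q` times. -/
def VarName.up (op : Op) (q : ℕ) (v : VarName) : VarName :=
  match op with
  | Op.shift => { v with shift := v.shift + q }
  | Op.dif => { v with der := v.der + q }

/-- Shift or differentiate an equation `q` times. -/
def EqLabel.up (op : Op) (q : ℕ) (l : EqLabel) : EqLabel :=
  match op with
  | Op.shift => { l with shift := l.shift + q }
  | Op.dif => { l with der := l.der + q }

/-- Whether the variable `v` belongs to a coloured vertex of the shifting graph or of the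
differentiation graph, respectively. -/
def classColor (op : Op) (colorV : Finset LVar) (v : VarName) : ℕ :=
  match op with
  | Op.shift => if (v.idx, v.shift) ∈ colorV then 1 else 0
  | Op.dif => if 0 ≤ v.shift ∧ (v.idx, (v.der : ℤ)) ∈ colorV then 1 else 0

/-- Update the shifting graph or the differentiation graph. -/
def updateTyped (op : Op) (s : SearchState) (G : LGraph) : LGraph :=
  updateGraph op LVar.up (fun q l => l + q) (fun v => if v ∈ s.colorV then 1 else 0)
    (fun j => if j ∈ s.colorE then 1 else 0) G

/-- Update the full graph. -/
def updateFull (op : Op) (s : SearchState) (G : BGraph VarName EqLabel) : BGraph VarName EqLabel :=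
  updateGraph op (VarName.up op) (EqLabel.up op) (classColor op s.colorV)
    (fun j => if j ∈ s.colorE then 1 else 0) G

/-! ### Differentiation during the shifting step -/

/-- `P` is a connection for the exposed equation `F_j`, where `C` is the set of equations that are
connected with `F_j` by an alternating path in the graph `H`: a connected set of alternating paths
`(F_a, v, F_b)`, with a non-matching edge `(F_a, v)` and a matching edge `(v, F_b)`, in which every
matched equation of `C` occurs exactly once as the end point `F_b`. -/
def IsConnection (H : LGraph) (assign : LVar → Option ℕ) (C : Finset ℕ) (j : ℕ)
    (P : Finset (ℕ × LVar × ℕ)) : Prop :=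
  (∀ a v b, (a, v, b) ∈ P → a ∈ C ∧ b ∈ C ∧ a ≠ b ∧ v ∈ H.vars ∧
    (v, a) ∈ H.edges ∧ (v, b) ∈ H.edges ∧ assign v = some b) ∧
  (∀ b ∈ C, b ≠ j → ∃! t : ℕ × LVar × ℕ, t ∈ P ∧ t.2.2 = b) ∧
  (∀ b ∈ C, Relation.ReflTransGen (fun a b => ∃ v, (a, v, b) ∈ P) j b)

/-- The highest order of differentiation with which a member of the vertex `v` of the shifting graph
appears in the equation `F_j`. -/
def highestDer (G : BGraph VarName EqLabel) (v : LVar) (j : ℕ) : ℕ :=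
  (G.edges.filter fun e => e.2 = j ∧ (e.1.idx, e.1.shift) = v).sup fun e => e.1.der

/-- `ν` assigns to the equations in `C` numbers of differentiations after which both end points of each
path `(F_a, v, F_b)` of `P` contain the same highest derivative from `v`. -/
def IsFeasible (G : BGraph VarName EqLabel) (C : Finset ℕ) (P : Finset (ℕ × LVar × ℕ))
    (ν : ℕ → ℕ) : Prop :=
  (∀ a v b, (a, v, b) ∈ P →
    (ν a : ℤ) - (ν b : ℤ) = (highestDer G v b : ℤ) - (highestDer G v a : ℤ)) ∧
  ∀ a, a ∉ C → ν a = 0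

/-- `ν` solves the linear integer program that belongs to the connection `P`. -/
def IsOptimal (G : BGraph VarName EqLabel) (C : Finset ℕ) (P : Finset (ℕ × LVar × ℕ))
    (ν : ℕ → ℕ) : Prop :=
  IsFeasible G C P ν ∧ ∀ ν', IsFeasible G C P ν' → ∑ a ∈ C, ν a ≤ ∑ a ∈ C, ν' a

/-- The number of differentiations of the equation `F_i`: the maximum over all connections of the
solutions of the linear integer programs. -/
noncomputable def numDif (G : BGraph VarName EqLabel) (H : LGraph) (s : SearchState) (j i : ℕ) : ℕ :=
  sSup {m | ∃ P ν, IsConnection H s.assign s.colorE j P ∧ IsOptimal G s.colorE P ν ∧ ν i = m}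

/-- The differentiation during the shifting step; `H` is the shifting graph restricted to highest
shifts, and `F_j` is the exposed equation. -/
noncomputable def difDuringShift (G : BGraph VarName EqLabel) (H : LGraph) (s : SearchState)
    (j : ℕ) : BGraph VarName EqLabel :=
  updateGraph Op.dif (VarName.up Op.dif) (EqLabel.up Op.dif)
    (fun v => (G.edges.filter fun e => e.1 = v).sup fun e => numDif G H s j e.2)
    (numDif G H s j) G

/-! ### Shifting step and differentiation step -/

/-- The update of the full graph after an unsuccessful search from the equation `F_r`. -/
noncomputable def fullStep (op : Op) (r : ℕ) (s : SearchState) (Gt : LGraph)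
    (G : BGraph VarName EqLabel) : BGraph VarName EqLabel :=
  match op with
  | Op.shift => updateFull Op.shift s (difDuringShift G (restrictHighest Gt) s r)
  | Op.dif => updateFull Op.dif s G

/-- The inner loop, for the equation `F_r`; `Gt` is the shifting or differentiation graph, and `G` the
full graph. -/
noncomputable def typedRepeat (σ : ℕ → Finset LVar → List LVar) (op : Op) (r : ℕ) :
    ℕ → (LVar → Option ℕ) → LGraph → BGraph VarName EqLabel →
      Option ((LVar → Option ℕ) × LGraph × BGraph VarName EqLabel)
  | 0, _, _, _ => none
  | N + 1, assign, Gt, G =>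
    (augmentPath σ (restrictHighest Gt) N r ⟨assign, ∅, ∅⟩).bind fun p =>
    if p.1 then some (p.2.assign, Gt, G)
    else typedRepeat σ op r N (raiseAssign p.2.assign p.2.colorV) (updateTyped op p.2 Gt)
      (fullStep op r p.2 Gt G)

/-- The generalization of the Pantelides algorithm to shifting and differentiation. -/
noncomputable def pantelidesTyped (σ : ℕ → Finset LVar → List LVar) (N : ℕ) (op : Op) (Gt : LGraph)
    (G : BGraph VarName EqLabel) : Option (BGraph VarName EqLabel) :=
  ((List.range Gt.M).foldlM (fun st r => typedRepeat σ op r N st.1 st.2.1 st.2.2)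
    ((fun _ => none : LVar → Option ℕ), Gt, G)).map fun st => st.2.2

/-! ### Trimmed linearization -/

/-- The highest order of differentiation of the non-delayed occurrences of the component `x_i`. -/
def maxOrder (G : BGraph VarName EqLabel) (i : ℕ) : ℕ :=
  (G.edges.filter fun e => e.1.idx = i ∧ 0 ≤ e.1.shift).sup fun e => e.1.der

/-- The highest shift with which a derivative of `x_i` of order at least `p` appears. -/
def maxShift (G : BGraph VarName EqLabel) (i p : ℕ) : ℕ :=
  (G.edges.filter fun e => e.1.idx = i ∧ p ≤ e.1.der).sup fun e => e.1.shift.toNat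

/-- The pairs `(i, p)` for which a new component `y_{i,p}`, which stands for the `p`-th derivative of
`x_i`, is introduced: `1 ≤ p < maxOrder G i`. -/
def newPairs (G : BGraph VarName EqLabel) : List (ℕ × ℕ) :=
  (List.range G.n).flatMap fun i => (List.range (maxOrder G i - 1)).map fun p => (i, p + 1)

/-- The index of the component `y_{i,p}`, with `y_{i,0} = x_i`; the new components are numbered
`n, n + 1, …`. -/
def newIdx (G : BGraph VarName EqLabel) (i p : ℕ) : ℕ :=
  if p = 0 then i else G.n + (newPairs G).idxOf (i, p)

/-- Replace the derivatives of `x_i` by new components and their first derivatives, if `x_i` is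
differentiated more than once. -/
def renameVar (G : BGraph VarName EqLabel) (v : VarName) : VarName :=
  let q := maxOrder G v.idx
  if 2 ≤ q ∧ 1 ≤ v.der ∧ v.der < q then ⟨newIdx G v.idx v.der, 0, v.shift⟩
  else if 2 ≤ q ∧ v.der = q then ⟨newIdx G v.idx (q - 1), 1, v.shift⟩
  else v

/-- The edges of the new equation with the number `m`, which is `(y_{i,p-1})' = y_{i,p}`, shifted
`maxShift G i p` times. -/
def newEdges (G : BGraph VarName EqLabel) (i p m : ℕ) : Finset (VarName × ℕ) :=
  {(⟨newIdx G i (p - 1), 1, maxShift G i p⟩, m), (⟨newIdx G i p, 0, maxShift G i p⟩, m)}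

/-- Trimmed linearization: the equations are reformulated as a first-order system. The variables of the
resulting graph are those that appear in some equation. -/
def trimmedLinearization (G : BGraph VarName EqLabel) : BGraph VarName EqLabel :=
  let N := newPairs G
  let E : Finset (VarName × ℕ) := (G.edges.image fun e => (renameVar G e.1, e.2)) ∪
    N.toFinset.biUnion fun ip => newEdges G ip.1 ip.2 (G.M + N.idxOf ip)
  { M := G.M + N.length
    n := G.n + N.length
    label := fun j => if j < G.M then G.label j else
      let ip := N.getD (j - G.M) (0, 0)
      ⟨0, maxShift G ip.1 ip.2⟩
    vars := E.image Prod.fst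
    edges := E }

/-! ### The complete algorithm -/

/-- The Pantelides algorithm for delay differential-algebraic equations: shifting step, trimmed
linearization and differentiation step. -/
noncomputable def pantelidesDDAE (σ : ℕ → Finset LVar → List LVar) (N : ℕ)
    (G : BGraph VarName EqLabel) : Option (BGraph VarName EqLabel) :=
  (pantelidesTyped σ N Op.shift (shiftingGraph G) G).bind fun G₁ =>
  let G₂ := trimmedLinearization G₁
  pantelidesTyped σ N Op.dif (differentiationGraph G₂) G₂

/-- The Pantelides algorithm for differential-algebraic equations, applied to `G`, terminates with the
result `H`. -/
def DAETerminatesWith (σ : ℕ → Finset LVar → List LVar) (G H : LGraph) : Prop :=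
  ∃ N, pantelidesDAE σ N G = some H

/-- The Pantelides algorithm for delay differential-algebraic equations, applied to `G`, terminates with
the result `H`. -/
def DDAETerminatesWith (σ : ℕ → Finset LVar → List LVar) (G H : BGraph VarName EqLabel) : Prop :=
  ∃ N, pantelidesDDAE σ N G = some H

end Pantelides

namespace Pantelides

/-! ## The search for an augmenting path -/

/-- The restriction of `a` to `U` is a matching in `H` that covers exactly the equations in `K`. -/
structure IsMatching (H : LGraph) (a : LVar → Option ℕ) (U : Set LVar) (K : Set ℕ) : Prop where
  mem : ∀ v ∈ U, ∀ k, a v = some k → k ∈ K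
  edge : ∀ v ∈ U, ∀ k, a v = some k → (v, k) ∈ H.edges
  inj : ∀ v ∈ U, ∀ w ∈ U, ∀ k, a v = some k → a w = some k → v = w
  cover : ∀ k ∈ K, ∃ v ∈ U, a v = some k

/-- `a'` arises from `a` by augmentation along a path that starts in the equation `F_j` and whose
variables are in `U`. -/
inductive Augments (H : LGraph) (a : LVar → Option ℕ) :
    Set LVar → ℕ → (LVar → Option ℕ) → Prop
  | exposed {U : Set LVar} {j : ℕ} {v : LVar} :
      v ∈ U → (v, j) ∈ H.edges → a v = none → Augments H a U j (Function.update a v (some j))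
  | matched {U : Set LVar} {j : ℕ} {v : LVar} {k : ℕ} {a' : LVar → Option ℕ} :
      v ∈ U → (v, j) ∈ H.edges → a v = some k → Augments H a (U \ {v}) k a' →
      Augments H a U j (Function.update a' v (some j))

theorem Augments.mono {H : LGraph} {a a' : LVar → Option ℕ} {U U' : Set LVar} {j : ℕ}
    (h : Augments H a U j a') (hU : U ⊆ U') : Augments H a U' j a' := by
  induction h generalizing U' with
  | exposed hv he ha => exact .exposed (hU hv) he ha
  | matched hv he ha _ ih =>
    exact .matched (hU hv) he ha (ih fun w hw => ⟨hU hw.1, hw.2⟩)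

/-- The old value at `v` is overwritten, so a matching is needed only away from `v`. -/
theorem IsMatching.update {H : LGraph} {a : LVar → Option ℕ} {U : Set LVar} {K : Set ℕ}
    {v : LVar} {j : ℕ} (h : IsMatching H a (U \ {v}) K) (hv : v ∈ U) (he : (v, j) ∈ H.edges)
    (hj : j ∉ K) : IsMatching H (Function.update a v (some j)) U (insert j K) where
  mem w hw k hk := by
    by_cases hwv : w = v
    · subst hwv
      simp only [Function.update_self, Option.some.injEq] at hk
      exact Or.inl hk.symm
    · rw [Function.update_of_ne hwv] at hk
      exact Or.inr (h.mem w ⟨hw, hwv⟩ k hk)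
  edge w hw k hk := by
    by_cases hwv : w = v
    · subst hwv
      simp only [Function.update_self, Option.some.injEq] at hk
      exact hk ▸ he
    · rw [Function.update_of_ne hwv] at hk
      exact h.edge w ⟨hw, hwv⟩ k hk
  inj w hw u hu k hwk huk := by
    by_cases hwv : w = v <;> by_cases huv : u = v
    · rw [hwv, huv]
    · subst hwv
      rw [Function.update_of_ne huv] at huk
      simp only [Function.update_self, Option.some.injEq] at hwk
      exact absurd (hwk ▸ h.mem u ⟨hu, huv⟩ k huk) hj
    · subst huv
      rw [Function.update_of_ne hwv] at hwk
      simp only [Function.update_self, Option.some.injEq] at huk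
      exact absurd (huk ▸ h.mem w ⟨hw, hwv⟩ k hwk) hj
    · rw [Function.update_of_ne hwv] at hwk
      rw [Function.update_of_ne huv] at huk
      exact h.inj w ⟨hw, hwv⟩ u ⟨hu, huv⟩ k hwk huk
  cover k hk := by
    rcases hk with rfl | hk
    · exact ⟨v, hv, by simp⟩
    · obtain ⟨w, hw, hwk⟩ := h.cover k hk
      exact ⟨w, hw.1, by rw [Function.update_of_ne hw.2, hwk]⟩

/-- In `Augments` the variable `v` leaves `U` once the path has passed it, so the path is simple and
the reassignments along it do not interfere. -/
theorem Augments.isMatching {H : LGraph} {a a' : LVar → Option ℕ} {U : Set LVar} {j : ℕ}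
    (h : Augments H a U j a') {K : Set ℕ} (ha : IsMatching H a U K) (hj : j ∉ K) :
    IsMatching H a' U (insert j K) := by
  induction h generalizing K with
  | @exposed U j v hv he hn =>
    refine IsMatching.update ⟨fun w hw => ha.mem w hw.1, fun w hw => ha.edge w hw.1,
      fun w hw u hu => ha.inj w hw.1 u hu.1, fun k hk => ?_⟩ hv he hj
    obtain ⟨w, hw, hwk⟩ := ha.cover k hk
    refine ⟨w, ⟨hw, ?_⟩, hwk⟩
    rintro rfl
    simp [hn] at hwk
  | @matched U j v k a' hv he hk _ ih =>
    -- Dropping `v` exposes `k`. The rest of the path covers `k` again, and `v` becomes free for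
    -- `j`.
    have h1 : IsMatching H a (U \ {v}) (K \ {k}) := by
      refine ⟨fun w hw m hm => ⟨ha.mem w hw.1 m hm, ?_⟩, fun w hw => ha.edge w hw.1,
        fun w hw u hu => ha.inj w hw.1 u hu.1, fun m hm => ?_⟩
      · rintro rfl
        exact hw.2 (ha.inj w hw.1 v hv m hm hk)
      · obtain ⟨w, hw, hwm⟩ := ha.cover m hm.1
        refine ⟨w, ⟨hw, ?_⟩, hwm⟩
        rintro rfl
        exact hm.2 (Option.some.inj (hwm.symm.trans hk))
    have h2 := ih h1 (fun h => h.2 rfl)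
    rw [Set.insert_sdiff_singleton, Set.insert_eq_of_mem (ha.mem v hv k hk)] at h2
    exact h2.update hv he hj

/-- What is known when the loop over the variables in `l`, adjacent to `F_j`, has led from the state
`s` to the state `s'` without finding an augmenting path. -/
structure SearchFails (H : LGraph) (j : ℕ) (l : List LVar) (s s' : SearchState) : Prop where
  assign_eq : s'.assign = s.assign
  subV : s.colorV ⊆ s'.colorV
  subE : s.colorE ⊆ s'.colorE
  list : ∀ v ∈ l, v ∈ s'.colorV
  new_var : ∀ v ∈ s'.colorV, v ∉ s.colorV → v ∈ H.vars ∧ ∃ k ∈ s'.colorE, s.assign v = some k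
  -- An equation coloured before this loop may still be in the middle of its own loop, so the claim
  -- is limited to new ones.
  new_eq : ∀ k ∈ s'.colorE, k ∉ s.colorE → ∀ v ∈ neighbours H k, v ∈ s'.colorV
  reach : ∀ Q : ℕ → Prop, Q j →
    (∀ k v k', Q k → v ∈ neighbours H k → s.assign v = some k' → Q k') →
    ∀ k ∈ s'.colorE, k ∉ s.colorE → Q k

/-- Outer induction on a bound for the number of uncoloured variables, which drops when the search
descends to a matched equation; inner induction on the list. The result is the same for every
sufficiently large bound `N`, so that runs can be composed. -/
theorem augmentLoop_spec {σ : ℕ → Finset LVar → List LVar} (hσ : IsEnumeration σ) (H : LGraph)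
    (n : ℕ) (l : List LVar) (j : ℕ) (s : SearchState) (hn : (H.vars \ s.colorV).card ≤ n)
    (hl : ∀ v ∈ l, v ∈ neighbours H j) :
    ∃ N₀ r, (∀ N ≥ N₀, augmentLoop σ H N j l s = some r) ∧
      (r.1 = true → Augments H s.assign (↑H.vars \ ↑s.colorV) j r.2.assign) ∧
      (r.1 = false → SearchFails H j l s r.2) := by
  induction n using Nat.strong_induction_on generalizing l j s with
  | _ n ihn =>
  induction l generalizing s with
  | nil =>
    refine ⟨0, (false, s), fun N _ => ?_, by simp, fun _ => ?_⟩
    · cases N <;> rfl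
    · exact ⟨rfl, subset_rfl, subset_rfl, by simp, fun v h h' => absurd h h',
        fun k h h' => absurd h h', fun Q _ _ k h h' => absurd h h'⟩
  | cons v l ihl =>
  have hvj := hl v (by simp)
  have hvH : v ∈ H.vars := (Finset.mem_filter.1 hvj).1
  have hve : (v, j) ∈ H.edges := (Finset.mem_filter.1 hvj).2
  have hl' : ∀ w ∈ l, w ∈ neighbours H j := fun w hw => hl w (by simp [hw])
  by_cases hv : v ∈ s.colorV
  · obtain ⟨N₀, r, hr, ht, hf⟩ := ihl s hn hl'
    refine ⟨N₀ + 1, r, fun N hN => ?_, ht, fun h => ?_⟩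
    · obtain ⟨N, rfl⟩ : ∃ m, N = m + 1 := ⟨N - 1, by omega⟩
      simp only [augmentLoop, if_pos hv]
      exact hr N (by omega)
    · have := hf h
      refine { this with list := fun w hw => ?_ }
      rcases List.mem_cons.1 hw with rfl | hw
      · exact this.subV hv
      · exact this.list w hw
  · rcases ha : s.assign v with _ | k
    · refine ⟨1, (true, { s with
          colorV := insert v s.colorV
          assign := Function.update s.assign v (some j) }), fun N hN => ?_, fun _ => ?_, by simp⟩
      · obtain ⟨N, rfl⟩ : ∃ m, N = m + 1 := ⟨N - 1, by omega⟩
        simp only [augmentLoop, if_neg hv, ha]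
      · exact .exposed ⟨hvH, hv⟩ hve ha
    · have hcard : (H.vars \ insert v s.colorV).card < (H.vars \ s.colorV).card := by
        refine Finset.card_lt_card ⟨Finset.sdiff_subset_sdiff subset_rfl (Finset.subset_insert _ _),
          fun h => ?_⟩
        have := h (Finset.mem_sdiff.2 ⟨hvH, hv⟩)
        simp at this
      obtain ⟨N₁, r₁, hr₁, ht₁, hf₁⟩ := ihn _ (lt_of_lt_of_le hcard hn) (σ k (neighbours H k)) k
        { s with colorV := insert v s.colorV, colorE := insert k s.colorE } le_rfl
        (fun w hw => ((hσ k (neighbours H k)).2 w).1 hw)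
      rcases hb : r₁.1 with _ | _
      · have hF := hf₁ hb
        obtain ⟨N₂, r₂, hr₂, ht₂, hf₂⟩ := ihl r₁.2
          (le_trans (Finset.card_le_card (Finset.sdiff_subset_sdiff subset_rfl
            ((Finset.subset_insert _ _).trans hF.subV))) hn) hl'
        have hsub : s.colorV ⊆ r₁.2.colorV := (Finset.subset_insert _ _).trans hF.subV
        have hvr : v ∈ r₁.2.colorV := hF.subV (Finset.mem_insert_self _ _)
        have hkr : k ∈ r₁.2.colorE := hF.subE (Finset.mem_insert_self _ _)
        have hassign : r₁.2.assign = s.assign := hF.assign_eq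
        refine ⟨max N₁ N₂ + 1, r₂, fun N hN => ?_, fun h => ?_, fun h => ?_⟩
        · obtain ⟨N, rfl⟩ : ∃ m, N = m + 1 := ⟨N - 1, by omega⟩
          simp only [augmentLoop, if_neg hv, ha]
          rw [hr₁ N (by omega)]
          simp only [Option.bind_some, hb]
          exact hr₂ N (by omega)
        · have := ht₂ h
          rw [hassign] at this
          exact this.mono fun w hw => ⟨hw.1, fun h => hw.2 (hsub h)⟩
        · have hG := hf₂ h
          refine ⟨hG.assign_eq.trans hassign, hsub.trans hG.subV,
            ((Finset.subset_insert _ _).trans hF.subE).trans hG.subE, fun w hw => ?_,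
            fun w hw hws => ?_, fun m hm hms => ?_, fun Q hQ hstep m hm hms => ?_⟩
          · rcases List.mem_cons.1 hw with rfl | hw
            · exact hG.subV hvr
            · exact hG.list w hw
          · by_cases hwr : w ∈ r₁.2.colorV
            · by_cases hwv : w = v
              · exact hwv ▸ ⟨hvH, k, hG.subE hkr, ha⟩
              · obtain ⟨h1, m, hm, h2⟩ := hF.new_var w hwr (by simp [hwv, hws])
                exact ⟨h1, m, hG.subE hm, h2⟩
            · rw [← hassign]
              exact hG.new_var w hw hwr
          · by_cases hmr : m ∈ r₁.2.colorE
            · intro w hw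
              refine hG.subV ?_
              by_cases hmk : m = k
              · subst hmk
                exact hF.list w (((hσ m (neighbours H m)).2 w).2 hw)
              · exact hF.new_eq m hmr (by simp [hmk, hms]) w hw
            · exact hG.new_eq m hm hmr
          · by_cases hmr : m ∈ r₁.2.colorE
            · have hQk : Q k := hstep j v k hQ hvj ha
              by_cases hmk : m = k
              · exact hmk ▸ hQk
              · exact hF.reach Q hQk hstep m hmr (by simp [hmk, hms])
            · exact hG.reach Q hQ (by rw [hassign]; exact hstep) m hm hmr
      · refine ⟨N₁ + 1, (true, { r₁.2 with assign := Function.update r₁.2.assign v (some j) }),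
          fun N hN => ?_, fun _ => ?_, by simp⟩
        · obtain ⟨N, rfl⟩ : ∃ m, N = m + 1 := ⟨N - 1, by omega⟩
          simp only [augmentLoop, if_neg hv, ha]
          rw [hr₁ N (by omega)]
          simp [hb]
        · refine .matched ⟨hvH, hv⟩ hve ha ((ht₁ hb).mono fun w hw => ⟨⟨hw.1, fun h => hw.2 ?_⟩,
            fun h => hw.2 ?_⟩)
          · simp only [Finset.coe_insert]
            exact Or.inr h
          · simp only [Finset.coe_insert]
            exact Or.inl h

/-- What is known about the coloured variables `CV` and the coloured equations `C` when no augmenting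
path that starts in `F_r` exists. -/
structure IsBlocked (H : LGraph) (a : LVar → Option ℕ) (r : ℕ) (CV : Finset LVar)
    (C : Finset ℕ) : Prop where
  root : r ∈ C
  nbr : ∀ k ∈ C, ∀ v ∈ neighbours H k, v ∈ CV
  var : ∀ v ∈ CV, v ∈ H.vars ∧ ∃ k ∈ C, a v = some k
  reach : ∀ Q : ℕ → Prop, Q r →
    (∀ k v k', Q k → v ∈ neighbours H k → a v = some k' → Q k') → ∀ k ∈ C, Q k

/-- When the search starts from `F_r`, exactly the equations with smaller number are covered. -/
theorem augmentPath_spec {σ : ℕ → Finset LVar → List LVar} (hσ : IsEnumeration σ) {H : LGraph}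
    {r : ℕ} {a : LVar → Option ℕ} (ha : IsMatching H a ↑H.vars {k | k < r}) :
    ∃ N₀ p, (∀ N ≥ N₀, augmentPath σ H N r ⟨a, ∅, ∅⟩ = some p) ∧
      (p.1 = true → IsMatching H p.2.assign ↑H.vars {k | k < r + 1}) ∧
      (p.1 = false → p.2.assign = a ∧ IsBlocked H a r p.2.colorV p.2.colorE) := by
  obtain ⟨N₀, p, hp, ht, hf⟩ := augmentLoop_spec hσ H _ (σ r (neighbours H r)) r
    ⟨a, ∅, insert r ∅⟩ le_rfl (fun w hw => ((hσ r (neighbours H r)).2 w).1 hw)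
  refine ⟨N₀, p, hp, fun h => ?_, fun h => ?_⟩
  · have h1 := ht h
    simp only [Finset.coe_empty, Set.sdiff_empty] at h1
    have h2 := h1.isMatching ha (by simp)
    convert h2 using 1
    ext k
    simp only [Set.mem_ofPred_eq, Set.mem_insert_iff]
    omega
  · have hF := hf h
    refine ⟨hF.assign_eq, hF.subE (by simp), fun k hk v hv => ?_,
      fun v hv => hF.new_var v hv (by simp), fun Q hQ hstep k hk => ?_⟩
    · by_cases hkr : k = r
      · subst hkr
        exact hF.list v (((hσ k (neighbours H k)).2 v).2 hv)
      · exact hF.new_eq k hk (by simpa using hkr) v hv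
    · by_cases hkr : k = r
      · exact hkr ▸ hQ
      · exact hF.reach Q hQ hstep k hk (by simpa using hkr)

end Pantelides
namespace Pantelides

/-! ## Hall's condition -/

/-- The edges `E` of a first-order system of `M` equations that is structurally nonsingular with
respect to the components of the unknown. -/
structure IsNonsingularSystem (M : ℕ) (E : Finset (LVar × ℕ)) : Prop where
  order : ∀ e ∈ E, e.1.2 = 0 ∨ e.1.2 = 1
  lt : ∀ e ∈ E, e.2 < M
  hall : ∀ S ⊆ Finset.range M, S.card ≤ ((E.filter (·.2 ∈ S)).image (·.1.1)).card

/-- The form in which Hall's condition is applied: sending a component to the equation in `T`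
matched with one of its variables is injective, so `S` has at most as many components, hence
equations, as `T`. -/
theorem IsNonsingularSystem.card_le {M : ℕ} {E : Finset (LVar × ℕ)}
    (hE : IsNonsingularSystem M E) {S T : Finset ℕ} (hS : S ⊆ Finset.range M) {U : Set LVar}
    {a : LVar → Option ℕ}
    (inj : ∀ v ∈ U, ∀ w ∈ U, ∀ k, a v = some k → a w = some k → v = w)
    (h : ∀ e ∈ E, e.2 ∈ S → ∃ v ∈ U, v.1 = e.1.1 ∧ ∃ k ∈ T, a v = some k) : S.card ≤ T.card := by
  refine (hE.hall S hS).trans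
    (Finset.card_le_card_of_forall_subsingleton (fun i k => ∃ v ∈ U, v.1 = i ∧ a v = some k) ?_ ?_)
  · intro i hi
    obtain ⟨e, he, rfl⟩ := Finset.mem_image.1 hi
    obtain ⟨v, hv, hvi, k, hk, hvk⟩ := h e (Finset.mem_filter.1 he).1 (Finset.mem_filter.1 he).2
    exact ⟨k, hk, v, hv, hvi, hvk⟩
  · rintro k - i ⟨-, v, hv, rfl, hvk⟩ i' ⟨-, w, hw, rfl, hwk⟩
    rw [inj v hv w hw k hvk hwk]

/-! ## Graphs of differentiated systems -/

/-- The graph of the system with the edges `E` after its `j`-th equation has been differentiated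
`ℓ j` times. -/
def levelGraph (M n : ℕ) (E : Finset (LVar × ℕ)) (ℓ : ℕ → ℕ) : LGraph where
  M := M
  n := n
  label := ℓ
  vars := (E.biUnion fun e => (Finset.range (ℓ e.2 + 1)).image fun p : ℕ =>
    (((e.1.1, e.1.2 + p), e.2) : LVar × ℕ)).image Prod.fst
  edges := E.biUnion fun e => (Finset.range (ℓ e.2 + 1)).image fun p : ℕ =>
    ((e.1.1, e.1.2 + p), e.2)

variable {M n : ℕ} {E : Finset (LVar × ℕ)} {ℓ c : ℕ → ℕ}

theorem mem_levelGraph_edges {v : LVar} {j : ℕ} :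
    (v, j) ∈ (levelGraph M n E ℓ).edges ↔
      ∃ k : ℤ, ((v.1, k), j) ∈ E ∧ k ≤ v.2 ∧ v.2 ≤ k + ℓ j := by
  simp only [levelGraph, Finset.mem_biUnion, Finset.mem_image, Finset.mem_range]
  constructor
  · rintro ⟨⟨⟨i, k⟩, j'⟩, he, p, hp, h⟩
    simp only [Prod.mk.injEq] at h
    obtain ⟨rfl, rfl⟩ := h
    dsimp only at hp ⊢
    exact ⟨k, he, by omega, by omega⟩
  · rintro ⟨k, he, h1, h2⟩
    refine ⟨((v.1, k), j), he, (v.2 - k).toNat, ?_, ?_⟩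
    · dsimp only
      omega
    · obtain ⟨i, m⟩ := v
      dsimp only at *
      rw [Int.toNat_of_nonneg (by omega)]
      simp

theorem mem_levelGraph_vars {v : LVar} :
    v ∈ (levelGraph M n E ℓ).vars ↔ ∃ j, (v, j) ∈ (levelGraph M n E ℓ).edges := by
  change v ∈ (levelGraph M n E ℓ).edges.image Prod.fst ↔ _
  simp

theorem levelGraph_edges_mono {v : LVar} {j : ℕ} (h : ℓ j ≤ c j)
    (hv : (v, j) ∈ (levelGraph M n E ℓ).edges) : (v, j) ∈ (levelGraph M n E c).edges := by
  rw [mem_levelGraph_edges] at hv ⊢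
  obtain ⟨k, h1, h2, h3⟩ := hv
  exact ⟨k, h1, h2, by omega⟩

theorem levelGraph_vars_mono (h : ∀ j, ℓ j ≤ c j) :
    (levelGraph M n E ℓ).vars ⊆ (levelGraph M n E c).vars := by
  intro v hv
  rw [mem_levelGraph_vars] at hv ⊢
  exact hv.imp fun j => levelGraph_edges_mono (h j)

theorem mem_restrictHighest_vars {G : LGraph} {v : LVar} :
    v ∈ (restrictHighest G).vars ↔ v ∈ G.vars ∧ IsHighest G.vars v :=
  Finset.mem_filter

theorem mem_restrictHighest_edges {G : LGraph} {v : LVar} {j : ℕ} :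
    (v, j) ∈ (restrictHighest G).edges ↔ (v, j) ∈ G.edges ∧ IsHighest G.vars v :=
  Finset.mem_filter

theorem mem_neighbours {H : LGraph} {v : LVar} {j : ℕ} :
    v ∈ neighbours H j ↔ v ∈ H.vars ∧ (v, j) ∈ H.edges :=
  Finset.mem_filter

theorem eq_of_mem_restrictHighest {G : LGraph} {v w : LVar} (hv : v ∈ (restrictHighest G).vars)
    (hw : w ∈ (restrictHighest G).vars) (h : v.1 = w.1) : v = w := by
  rw [mem_restrictHighest_vars] at hv hw
  exact Prod.ext h (le_antisymm (hw.2.2 v hv.1 h) (hv.2.2 w hw.1 h.symm))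

theorem exists_highest {G : LGraph} {v : LVar} (hv : v ∈ G.vars) (h0 : 0 ≤ v.2) :
    ∃ w ∈ (restrictHighest G).vars, w.1 = v.1 ∧ v.2 ≤ w.2 := by
  obtain ⟨w, hw, hmax⟩ := Finset.exists_max_image (G.vars.filter (·.1 = v.1)) (·.2)
    ⟨v, Finset.mem_filter.2 ⟨hv, rfl⟩⟩
  obtain ⟨hwG, hwv⟩ := Finset.mem_filter.1 hw
  have hvw := hmax v (Finset.mem_filter.2 ⟨hv, rfl⟩)
  refine ⟨w, mem_restrictHighest_vars.2 ⟨hwG, h0.trans hvw, fun u hu huw => ?_⟩, hwv, hvw⟩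
  exact hmax u (Finset.mem_filter.2 ⟨hu, huw.trans hwv⟩)

/-- If `F_k` contains the highest derivative for the levels `c` already at the level `ℓ k`, then
`c k ≤ ℓ k`. -/
theorem le_of_isHighest {v : LVar} {k : ℕ} (hv : (v, k) ∈ (levelGraph M n E ℓ).edges)
    (hc : IsHighest (levelGraph M n E c).vars v) : c k ≤ ℓ k := by
  obtain ⟨d, h1, h2, h3⟩ := mem_levelGraph_edges.1 hv
  have := hc.2 (v.1, d + c k) (mem_levelGraph_vars.2 ⟨k, mem_levelGraph_edges.2
    ⟨d, h1, by simp, le_rfl⟩⟩) rfl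
  dsimp only at this
  omega

/-- The levels after one further differentiation of the equations in `C`. -/
def raiseLevel (ℓ : ℕ → ℕ) (C : Finset ℕ) (j : ℕ) : ℕ :=
  if j ∈ C then ℓ j + 1 else ℓ j

theorem le_raiseLevel (C : Finset ℕ) (j : ℕ) : ℓ j ≤ raiseLevel ℓ C j := by
  unfold raiseLevel
  split <;> omega

theorem mem_raiseLevel_edges {C : Finset ℕ} {v : LVar} {j : ℕ} :
    (v, j) ∈ (levelGraph M n E (raiseLevel ℓ C)).edges ↔
      (v, j) ∈ (levelGraph M n E ℓ).edges ∨
        j ∈ C ∧ ((v.1, v.2 - 1), j) ∈ (levelGraph M n E ℓ).edges := by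
  simp only [mem_levelGraph_edges, raiseLevel]
  split_ifs with hj
  · constructor
    · rintro ⟨k, h1, h2, h3⟩
      push_cast at h3
      by_cases h : v.2 ≤ k + ℓ j
      · exact Or.inl ⟨k, h1, h2, h⟩
      · exact Or.inr ⟨hj, k, h1, by omega, by omega⟩
    · rintro (⟨k, h1, h2, h3⟩ | ⟨-, k, h1, h2, h3⟩)
      · exact ⟨k, h1, h2, by push_cast; omega⟩
      · exact ⟨k, h1, by omega, by push_cast; omega⟩
  · simp [hj]

/-! ### The effect of a failed search on levels and matching -/

section Blocked

variable {a : LVar → Option ℕ} {r : ℕ} {CV : Finset LVar} {C : Finset ℕ}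

/-- Differentiating the coloured equations creates new variables only above coloured ones: the
derivative of a variable that is not highest is already present. -/
theorem mem_raiseLevel_vars (hE : IsNonsingularSystem M E)
    (ha : IsMatching (restrictHighest (levelGraph M n E ℓ)) a
      ↑(restrictHighest (levelGraph M n E ℓ)).vars {k | k < r})
    (hb : IsBlocked (restrictHighest (levelGraph M n E ℓ)) a r CV C) {v : LVar} :
    v ∈ (levelGraph M n E (raiseLevel ℓ C)).vars ↔
      v ∈ (levelGraph M n E ℓ).vars ∨ (v.1, v.2 - 1) ∈ CV := by
  constructor
  · intro hv
    obtain ⟨j, hj⟩ := mem_levelGraph_vars.1 hv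
    rcases mem_raiseLevel_edges.1 hj with h | ⟨hjC, h⟩
    · exact Or.inl (mem_levelGraph_vars.2 ⟨j, h⟩)
    · have hw : ((v.1, v.2 - 1) : LVar) ∈ (levelGraph M n E ℓ).vars :=
        mem_levelGraph_vars.2 ⟨j, h⟩
      obtain ⟨k, hk, hk1, -⟩ := mem_levelGraph_edges.1 h
      have hk0 := hE.order _ hk
      dsimp only at hk0 hk1
      by_cases hh : IsHighest (levelGraph M n E ℓ).vars (v.1, v.2 - 1)
      · exact Or.inr (hb.nbr j hjC _ (mem_neighbours.2
          ⟨mem_restrictHighest_vars.2 ⟨hw, hh⟩, mem_restrictHighest_edges.2 ⟨h, hh⟩⟩))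
      · left
        -- The original orders are 0 or 1, so the equation containing the highest derivative `u`
        -- contains all orders of this component from 1 up to that of `u`, among them `v`.
        obtain ⟨u, hu, huv, hle⟩ := exists_highest hw (by dsimp only; omega)
        have hne : u.2 ≠ v.2 - 1 := by
          intro h'
          have : u = (v.1, v.2 - 1) := Prod.ext huv h'
          exact hh (this ▸ (mem_restrictHighest_vars.1 hu).2)
        obtain ⟨j', hj'⟩ := mem_levelGraph_vars.1 (mem_restrictHighest_vars.1 hu).1
        obtain ⟨d, hd, hd1, hd2⟩ := mem_levelGraph_edges.1 hj'
        have hd0 := hE.order _ hd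
        dsimp only at hd0 hle huv
        refine mem_levelGraph_vars.2 ⟨j', mem_levelGraph_edges.2 ⟨d, ?_, by omega, by omega⟩⟩
        rwa [← huv]
  · rintro (hv | hv)
    · exact levelGraph_vars_mono (le_raiseLevel C) hv
    · obtain ⟨hvH, k, hk, hak⟩ := hb.var _ hv
      exact mem_levelGraph_vars.2 ⟨k, mem_raiseLevel_edges.2
        (Or.inr ⟨hk, (mem_restrictHighest_edges.1 (ha.edge _ hvH k hak)).1⟩)⟩

theorem raiseAssign_of_mem (hb : IsBlocked (restrictHighest (levelGraph M n E ℓ)) a r CV C)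
    {v : LVar} (hv : (v.1, v.2 - 1) ∈ CV) : raiseAssign a CV v = a (v.1, v.2 - 1) := by
  obtain ⟨-, k, -, hk⟩ := hb.var _ hv
  exact if_pos ⟨hv, by rw [hk]; rfl⟩

theorem raiseAssign_of_notMem {v : LVar} (hv : (v.1, v.2 - 1) ∉ CV) : raiseAssign a CV v = a v :=
  if_neg fun h => hv h.1

theorem mem_restrictHighest_raiseLevel (hE : IsNonsingularSystem M E)
    (ha : IsMatching (restrictHighest (levelGraph M n E ℓ)) a
      ↑(restrictHighest (levelGraph M n E ℓ)).vars {k | k < r})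
    (hb : IsBlocked (restrictHighest (levelGraph M n E ℓ)) a r CV C) {v : LVar} :
    v ∈ (restrictHighest (levelGraph M n E (raiseLevel ℓ C))).vars ↔
      (v.1, v.2 - 1) ∈ CV ∨
        (v ∈ (restrictHighest (levelGraph M n E ℓ)).vars ∧ v ∉ CV ∧ (v.1, v.2 - 1) ∉ CV) := by
  have hvars : ∀ {w : LVar}, w ∈ (levelGraph M n E (raiseLevel ℓ C)).vars ↔
      w ∈ (levelGraph M n E ℓ).vars ∨ (w.1, w.2 - 1) ∈ CV := mem_raiseLevel_vars hE ha hb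
  constructor
  · intro hv
    obtain ⟨hv1, hv2⟩ := mem_restrictHighest_vars.1 hv
    by_cases hc : (v.1, v.2 - 1) ∈ CV
    · exact Or.inl hc
    have hvG := (hvars.1 hv1).resolve_right hc
    refine Or.inr ⟨mem_restrictHighest_vars.2 ⟨hvG, hv2.1, fun w hw => hv2.2 w
      (hvars.2 (Or.inl hw))⟩, fun h => ?_, hc⟩
    have := hv2.2 (v.1, v.2 + 1) (hvars.2 (Or.inr (by simpa using h))) rfl
    dsimp only at this
    omega
  · rintro (hv | ⟨hv, hvC, -⟩)
    · obtain ⟨-, hh⟩ := mem_restrictHighest_vars.1 (hb.var _ hv).1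
      refine mem_restrictHighest_vars.2 ⟨hvars.2 (Or.inr hv), ?_, fun w hw hwv => ?_⟩
      · have := hh.1
        dsimp only at this
        omega
      · rcases hvars.1 hw with h | h
        · have := hh.2 w h hwv
          dsimp only at this
          omega
        · have := hh.2 _ (mem_restrictHighest_vars.1 (hb.var _ h).1).1 hwv
          dsimp only at this
          omega
    · obtain ⟨hvG, hh⟩ := mem_restrictHighest_vars.1 hv
      refine mem_restrictHighest_vars.2 ⟨hvars.2 (Or.inl hvG), hh.1, fun w hw hwv => ?_⟩
      rcases hvars.1 hw with h | h
      · exact hh.2 w h hwv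
      · exact absurd (eq_of_mem_restrictHighest (hb.var _ h).1 hv hwv ▸ h) hvC

/-- `raiseAssign` leaves stale values at the coloured variables, but these are no longer highest.
This is why matchings are restricted to the set of highest derivatives. -/
theorem IsMatching.raise (hE : IsNonsingularSystem M E)
    (ha : IsMatching (restrictHighest (levelGraph M n E ℓ)) a
      ↑(restrictHighest (levelGraph M n E ℓ)).vars {k | k < r})
    (hb : IsBlocked (restrictHighest (levelGraph M n E ℓ)) a r CV C) :
    IsMatching (restrictHighest (levelGraph M n E (raiseLevel ℓ C))) (raiseAssign a CV)
      ↑(restrictHighest (levelGraph M n E (raiseLevel ℓ C))).vars {k | k < r} := by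
  have hmem : ∀ {w : LVar}, w ∈ (restrictHighest (levelGraph M n E (raiseLevel ℓ C))).vars ↔ _ :=
    mem_restrictHighest_raiseLevel hE ha hb
  refine ⟨fun v hv k hk => ?_, fun v hv k hk => ?_, fun v hv w hw k hvk hwk => ?_, fun k hk => ?_⟩
  · rcases hmem.1 hv with h | ⟨h, -, hn⟩
    · rw [raiseAssign_of_mem hb h] at hk
      exact ha.mem _ (hb.var _ h).1 k hk
    · rw [raiseAssign_of_notMem hn] at hk
      exact ha.mem v h k hk
  · refine mem_restrictHighest_edges.2 ⟨?_, (mem_restrictHighest_vars.1 hv).2⟩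
    rcases hmem.1 hv with h | ⟨h, -, hn⟩
    · rw [raiseAssign_of_mem hb h] at hk
      obtain ⟨hH, k', hk', hak⟩ := hb.var _ h
      obtain rfl : k = k' := Option.some.inj (hk.symm.trans hak)
      exact mem_raiseLevel_edges.2
        (Or.inr ⟨hk', (mem_restrictHighest_edges.1 (ha.edge _ hH k hak)).1⟩)
    · rw [raiseAssign_of_notMem hn] at hk
      exact mem_raiseLevel_edges.2 (Or.inl (mem_restrictHighest_edges.1 (ha.edge v h k hk)).1)
  · rcases hmem.1 hv with h | ⟨h, hc, hn⟩ <;> rcases hmem.1 hw with h' | ⟨h', hc', hn'⟩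
    · rw [raiseAssign_of_mem hb h] at hvk
      rw [raiseAssign_of_mem hb h'] at hwk
      have := ha.inj _ (hb.var _ h).1 _ (hb.var _ h').1 k hvk hwk
      simp only [Prod.mk.injEq, sub_left_inj] at this
      exact Prod.ext this.1 this.2
    · rw [raiseAssign_of_mem hb h] at hvk
      rw [raiseAssign_of_notMem hn'] at hwk
      exact absurd (ha.inj _ (hb.var _ h).1 _ h' k hvk hwk ▸ h) hc'
    · rw [raiseAssign_of_notMem hn] at hvk
      rw [raiseAssign_of_mem hb h'] at hwk
      exact absurd (ha.inj _ (hb.var _ h').1 _ h k hwk hvk ▸ h') hc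
    · rw [raiseAssign_of_notMem hn] at hvk
      rw [raiseAssign_of_notMem hn'] at hwk
      exact ha.inj _ h _ h' k hvk hwk
  · obtain ⟨v, hv, hvk⟩ := ha.cover k hk
    by_cases hvC : v ∈ CV
    · have h : ((v.1, v.2 + 1 - 1) : LVar) ∈ CV := by simpa using hvC
      refine ⟨(v.1, v.2 + 1), hmem.2 (Or.inl h), ?_⟩
      rw [raiseAssign_of_mem hb h]
      simpa using hvk
    -- Coloured variables are highest, and a component has only one highest derivative.
    · have hn : ((v.1, v.2 - 1) : LVar) ∉ CV := by
        intro h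
        have := eq_of_mem_restrictHighest (hb.var _ h).1 hv rfl
        exact hvC (this ▸ h)
      exact ⟨v, hmem.2 (Or.inr ⟨hv, hvC, hn⟩), by rw [raiseAssign_of_notMem hn, hvk]⟩

/-- A raised variable inherits a matching edge, so no new exposed variable arises. -/
theorem exposed_le_raise (hE : IsNonsingularSystem M E)
    (ha : IsMatching (restrictHighest (levelGraph M n E ℓ)) a
      ↑(restrictHighest (levelGraph M n E ℓ)).vars {k | k < r})
    (hb : IsBlocked (restrictHighest (levelGraph M n E ℓ)) a r CV C) {B : ℕ}
    (hB : ∀ v ∈ (restrictHighest (levelGraph M n E ℓ)).vars, a v = none → v.2 ≤ B) :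
    ∀ v ∈ (restrictHighest (levelGraph M n E (raiseLevel ℓ C))).vars,
      raiseAssign a CV v = none → v.2 ≤ B := by
  intro v hv hvn
  rcases (mem_restrictHighest_raiseLevel hE ha hb).1 hv with h | ⟨h, -, hn⟩
  · rw [raiseAssign_of_mem hb h] at hvn
    obtain ⟨-, k, -, hk⟩ := hb.var _ h
    simp [hk] at hvn
  · rw [raiseAssign_of_notMem hn] at hvn
    exact hB v h hvn

theorem BGraph.ext_of {V L : Type} {G H : BGraph V L} (hM : G.M = H.M) (hn : G.n = H.n)
    (hl : G.label = H.label) (hv : G.vars = H.vars) (he : G.edges = H.edges) : G = H := by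
  cases G
  cases H
  simp_all

theorem daeUpdate_levelGraph (hE : IsNonsingularSystem M E)
    (ha : IsMatching (restrictHighest (levelGraph M n E ℓ)) a
      ↑(restrictHighest (levelGraph M n E ℓ)).vars {k | k < r})
    (hb : IsBlocked (restrictHighest (levelGraph M n E ℓ)) a r CV C) (a' : LVar → Option ℕ) :
    daeUpdate (levelGraph M n E ℓ) ⟨a', CV, C⟩ = levelGraph M n E (raiseLevel ℓ C) := by
  refine BGraph.ext_of rfl rfl rfl ?_ ?_
  · ext v
    rw [mem_raiseLevel_vars hE ha hb]
    simp only [daeUpdate, Finset.mem_union, Finset.mem_image, Finset.mem_filter]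
    refine or_congr Iff.rfl ⟨?_, fun h => ⟨_, ⟨(mem_restrictHighest_vars.1 (hb.var _ h).1).1, h⟩,
      by simp⟩⟩
    rintro ⟨w, ⟨-, hw⟩, rfl⟩
    simpa using hw
  · ext ⟨v, j⟩
    rw [mem_raiseLevel_edges]
    simp only [daeUpdate, Finset.mem_union, Finset.mem_image, Finset.mem_filter]
    refine or_congr Iff.rfl ⟨?_, fun h => ⟨_, ⟨h.2, h.1⟩, by simp⟩⟩
    rintro ⟨⟨w, k⟩, ⟨hw, hk⟩, h⟩
    simp only [Prod.mk.injEq] at h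
    obtain ⟨rfl, rfl⟩ := h
    exact ⟨hk, by simpa using hw⟩

/-- The two update rules add variables differently, but on level graphs every added variable already
occurs in a differentiated equation. -/
theorem updateTyped_levelGraph (hE : IsNonsingularSystem M E)
    (ha : IsMatching (restrictHighest (levelGraph M n E ℓ)) a
      ↑(restrictHighest (levelGraph M n E ℓ)).vars {k | k < r})
    (hb : IsBlocked (restrictHighest (levelGraph M n E ℓ)) a r CV C) (a' : LVar → Option ℕ) :
    updateTyped Op.dif ⟨a', CV, C⟩ (levelGraph M n E ℓ) = levelGraph M n E (raiseLevel ℓ C) := by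
  have hedges : (updateTyped Op.dif ⟨a', CV, C⟩ (levelGraph M n E ℓ)).edges =
      (levelGraph M n E (raiseLevel ℓ C)).edges := by
    ext ⟨v, j⟩
    rw [mem_raiseLevel_edges]
    simp only [updateTyped, updateGraph, Finset.mem_union, Finset.mem_image, Finset.mem_biUnion,
      Finset.mem_Icc, LVar.up]
    refine or_congr Iff.rfl ⟨?_, fun h => ⟨_, h.2, 1, by simp [h.1], by simp⟩⟩
    rintro ⟨⟨w, k⟩, hw, p, ⟨hp1, hp2⟩, h⟩
    split_ifs at hp2 with hk
    · obtain rfl : p = 1 := by omega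
      simp only [Prod.mk.injEq] at h
      obtain ⟨rfl, rfl⟩ := h
      exact ⟨hk, by simpa using hw⟩
    · omega
  refine BGraph.ext_of rfl rfl ?_ ?_ hedges
  · funext j
    simp only [updateTyped, updateGraph, levelGraph, raiseLevel]
    split <;> rfl
  · have hv : (updateTyped Op.dif ⟨a', CV, C⟩ (levelGraph M n E ℓ)).vars =
        (levelGraph M n E ℓ).vars ∪ ((levelGraph M n E ℓ).vars.biUnion fun v =>
          (Finset.Icc 1 (if v ∈ CV then 1 else 0)).image fun p => LVar.up p v) ∪
        (levelGraph M n E (raiseLevel ℓ C)).vars := by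
      change _ = _ ∪ _ ∪ (levelGraph M n E (raiseLevel ℓ C)).edges.image Prod.fst
      rw [← hedges]
      rfl
    rw [hv, Finset.union_eq_right]
    intro v hv
    rw [mem_raiseLevel_vars hE ha hb]
    simp only [Finset.mem_union, Finset.mem_image, Finset.mem_biUnion,
      Finset.mem_Icc, LVar.up] at hv
    refine hv.imp_right ?_
    rintro ⟨w, -, p, ⟨hp1, hp2⟩, rfl⟩
    split_ifs at hp2 with hk
    · obtain rfl : p = 1 := by omega
      simpa using hk
    · omega

/-! ### Minimality of the levels and termination -/

/-- The levels `c` admit a matching of the highest derivatives that covers all equations. -/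
def IsSaturated (M n : ℕ) (E : Finset (LVar × ℕ)) (c : ℕ → ℕ) : Prop :=
  ∃ a, IsMatching (restrictHighest (levelGraph M n E c)) a
    ↑(restrictHighest (levelGraph M n E c)).vars {k | k < M}

theorem IsBlocked.lt (hE : IsNonsingularSystem M E) (hr : r < M)
    (ha : IsMatching (restrictHighest (levelGraph M n E ℓ)) a
      ↑(restrictHighest (levelGraph M n E ℓ)).vars {k | k < r})
    (hb : IsBlocked (restrictHighest (levelGraph M n E ℓ)) a r CV C) : ∀ k ∈ C, k < M :=
  hb.reach (· < M) hr fun k v k' _ hv hk' => by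
    have h := (mem_restrictHighest_edges.1 (ha.edge v (mem_neighbours.1 hv).1 k' hk')).1
    obtain ⟨d, hd, -⟩ := mem_levelGraph_edges.1 h
    exact hE.lt _ hd

/-- The levels of the equations that are about to be differentiated are smaller than in every
saturated system of levels above the current one. -/
theorem IsBlocked.raiseLevel_le (hE : IsNonsingularSystem M E) (hr : r < M)
    (ha : IsMatching (restrictHighest (levelGraph M n E ℓ)) a
      ↑(restrictHighest (levelGraph M n E ℓ)).vars {k | k < r})
    (hb : IsBlocked (restrictHighest (levelGraph M n E ℓ)) a r CV C)
    (hc : IsSaturated M n E c) (hle : ∀ j, ℓ j ≤ c j) : ∀ j, raiseLevel ℓ C j ≤ c j := by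
  obtain ⟨b, hbm⟩ := hc
  have hlt := hb.lt hE hr ha
  -- `T` consists of the coloured equations that must not be raised; the aim is to show that it is
  -- empty. The partner under `b` of an equation in `T` is highest for `c` and hence for `ℓ`, and
  -- its partner under `a` lies in `T` again.
  set T : Finset ℕ := C.filter fun j => ℓ j = c j with hT
  have key : ∀ j ∈ T, ∃ v ∈ (restrictHighest (levelGraph M n E c)).vars, b v = some j ∧
      v ∈ neighbours (restrictHighest (levelGraph M n E ℓ)) j ∧ ∃ k ∈ T, a v = some k := by
    intro j hj
    obtain ⟨hjC, hjc⟩ := Finset.mem_filter.1 hj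
    obtain ⟨v, hv, hvj⟩ := hbm.cover j (hlt j hjC)
    have hvh := (mem_restrictHighest_vars.1 hv).2
    have he : (v, j) ∈ (levelGraph M n E ℓ).edges :=
      levelGraph_edges_mono hjc.ge (mem_restrictHighest_edges.1 (hbm.edge v hv j hvj)).1
    have hhl : IsHighest (levelGraph M n E ℓ).vars v :=
      ⟨hvh.1, fun w hw => hvh.2 w (levelGraph_vars_mono hle hw)⟩
    have hvH : v ∈ (restrictHighest (levelGraph M n E ℓ)).vars :=
      mem_restrictHighest_vars.2 ⟨mem_levelGraph_vars.2 ⟨j, he⟩, hhl⟩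
    have hnb : v ∈ neighbours (restrictHighest (levelGraph M n E ℓ)) j :=
      mem_neighbours.2 ⟨hvH, mem_restrictHighest_edges.2 ⟨he, hhl⟩⟩
    obtain ⟨-, k, hk, hak⟩ := hb.var v (hb.nbr j hjC v hnb)
    refine ⟨v, hv, hvj, hnb, k, Finset.mem_filter.2 ⟨hk, le_antisymm (hle k) ?_⟩, hak⟩
    exact le_of_isHighest (mem_restrictHighest_edges.1 (ha.edge v hvH k hak)).1 hvh
  choose! m hm1 hm2 hm3 g hg hmg using key
  have hginj : Set.InjOn g ↑T := by
    intro i hi j hj hij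
    have h1 := hmg i hi
    rw [hij] at h1
    have h2 := ha.inj _ (mem_neighbours.1 (hm3 i hi)).1 _ (mem_neighbours.1 (hm3 j hj)).1 _ h1
      (hmg j hj)
    exact Option.some.inj ((hm2 i hi).symm.trans (h2 ▸ hm2 j hj))
  -- An injective map of the finite set `T` to itself is onto, so within `a` the equations of `T`
  -- are matched exactly with the variables `m j`.
  have hgsurj : ∀ k ∈ T, ∃ j ∈ T, g j = k := by
    have := Finset.surj_on_of_inj_on_of_card_le (s := T) (t := T) (fun j _ => g j) hg
      (fun i j hi hj h => hginj hi hj h) le_rfl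
    intro k hk
    obtain ⟨j, hj, h⟩ := this k hk
    exact ⟨j, hj, h.symm⟩
  have hrT : r ∉ T := by
    intro h
    obtain ⟨j, hj, hjr⟩ := hgsurj r h
    have := ha.mem _ (mem_neighbours.1 (hm3 j hj)).1 _ (hmg j hj)
    rw [hjr] at this
    exact lt_irrefl r this
  -- No alternating path from `r` enters `T`: its last variable would be some `m j`, highest for
  -- `c`, so the preceding equation would have reached its level in `c` too.
  have hQ : ∀ k ∈ C, k ∈ C ∧ k ∉ T := by
    refine hb.reach (fun k => k ∈ C ∧ k ∉ T) ⟨hb.root, hrT⟩ fun k v k' hk hv hvk' => ?_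
    obtain ⟨hvH, k'', hk'', hvk''⟩ := hb.var v (hb.nbr k hk.1 v hv)
    obtain rfl : k' = k'' := Option.some.inj (hvk'.symm.trans hvk'')
    refine ⟨hk'', fun hk'T => hk.2 ?_⟩
    obtain ⟨j, hj, rfl⟩ := hgsurj k' hk'T
    obtain rfl := ha.inj _ hvH _ (mem_neighbours.1 (hm3 j hj)).1 _ hvk' (hmg j hj)
    refine Finset.mem_filter.2 ⟨hk.1, le_antisymm (hle k) ?_⟩
    exact le_of_isHighest (mem_restrictHighest_edges.1 (mem_neighbours.1 hv).2).1
      (mem_restrictHighest_vars.1 (hm1 j hj)).2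
  intro j
  unfold raiseLevel
  split_ifs with hj
  · have h1 := (hQ j hj).2
    have h2 := hle j
    have h3 : ℓ j ≠ c j := fun h => h1 (Finset.mem_filter.2 ⟨hj, h⟩)
    omega
  · exact hle j

/-- As long as the exposed variables have bounded order, so has the exposed equation `F_r`. -/
theorem level_lt (hE : IsNonsingularSystem M E) (hr : r < M)
    (ha : IsMatching (restrictHighest (levelGraph M n E ℓ)) a
      ↑(restrictHighest (levelGraph M n E ℓ)).vars {k | k < r}) {B : ℕ}
    (hB : ∀ v ∈ (restrictHighest (levelGraph M n E ℓ)).vars, a v = none → v.2 ≤ B) :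
    ℓ r < B + M := by
  by_contra! hlr
  -- Equations within `t` of the level of `F_r` have only components whose highest derivative
  -- exceeds order `B`, hence is matched. The partner is at most one level lower, since original
  -- orders are at most 1, and differs from the exposed `F_r`. By Hall's condition the set therefore
  -- grows with each `t`; at `t = M` it would exceed the number of equations.
  have key : ∀ t, B + t ≤ ℓ r → t + 1 ≤ ((Finset.range M).filter fun j => ℓ r ≤ ℓ j + t).card := by
    intro t
    induction t with
    | zero =>
      intro _
      exact Finset.card_pos.2 ⟨r, by simp [hr]⟩
    | succ t ih =>
      intro ht
      have h1 := ih (by omega)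
      have h2 : ((Finset.range M).filter fun j => ℓ r ≤ ℓ j + t).card ≤
          (((Finset.range M).filter fun j => ℓ r ≤ ℓ j + (t + 1)).erase r).card := by
        refine hE.card_le (Finset.filter_subset _ _) ha.inj fun e he hj => ?_
        have hj := (Finset.mem_filter.1 hj).2
        have h0 := hE.order e he
        obtain ⟨w, hw, hwe, hle⟩ := exists_highest (G := levelGraph M n E ℓ)
          (v := (e.1.1, e.1.2 + ℓ e.2)) (mem_levelGraph_vars.2 ⟨e.2, mem_levelGraph_edges.2
            ⟨e.1.2, he, by simp, le_rfl⟩⟩) (by dsimp only; omega)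
        refine ⟨w, hw, hwe, ?_⟩
        dsimp only at hle
        rcases hwa : a w with _ | k
        · have := hB w hw hwa
          omega
        · refine ⟨k, ?_, rfl⟩
          obtain ⟨d, hd, -, hd2⟩ := mem_levelGraph_edges.1
            (mem_restrictHighest_edges.1 (ha.edge w hw k hwa)).1
          have hd0 := hE.order _ hd
          have hkM := hE.lt _ hd
          have hkr : k < r := ha.mem w hw k hwa
          dsimp only at hd0 hkM
          simp only [Finset.mem_erase, Finset.mem_filter, Finset.mem_range]
          refine ⟨by omega, hkM, by omega⟩
      have h3 : r ∈ (Finset.range M).filter fun j => ℓ r ≤ ℓ j + (t + 1) := by simp [hr]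
      have h4 := Finset.card_erase_add_one h3
      omega
  have h1 := key M hlr
  have h2 := Finset.card_filter_le (Finset.range M) fun j => ℓ r ≤ ℓ j + M
  rw [Finset.card_range] at h2
  omega

end Blocked

end Pantelides
namespace Pantelides

/-! ## Differentiation of the full graph -/

/-- Colours of full variables are pulled back from the merged vertices, and differentiation leaves
shifts alone, so delayed variables stay delayed. -/
theorem differentiationGraph_updateFull (s : SearchState) (G : BGraph VarName EqLabel) :
    differentiationGraph (updateFull Op.dif s G) =
      updateTyped Op.dif s (differentiationGraph G) := by
  have hedges : (differentiationGraph (updateFull Op.dif s G)).edges =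
      (updateTyped Op.dif s (differentiationGraph G)).edges := by
    ext ⟨⟨i, k⟩, j⟩
    simp only [differentiationGraph, deleteDelayed, updateFull, updateTyped, updateGraph,
      Finset.mem_image, Finset.mem_filter, Finset.mem_union, Finset.mem_biUnion, Finset.mem_Icc]
    constructor
    · rintro ⟨e, ⟨he | ⟨f, hf, p, hp, rfl⟩, h0⟩, h⟩
      · exact Or.inl ⟨e, ⟨he, h0⟩, h⟩
      · exact Or.inr ⟨_, ⟨f, ⟨hf, h0⟩, rfl⟩, p, hp, by rw [← h]; simp [LVar.up, VarName.up]⟩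
    · rintro (⟨e, ⟨he, h0⟩, h⟩ | ⟨_, ⟨f, ⟨hf, h0⟩, rfl⟩, p, hp, h⟩)
      · exact ⟨e, ⟨Or.inl he, h0⟩, h⟩
      · exact ⟨_, ⟨Or.inr ⟨f, hf, p, hp, rfl⟩, h0⟩, by rw [← h]; simp [LVar.up, VarName.up]⟩
  refine BGraph.ext_of rfl rfl rfl ?_ hedges
  have h1 : (updateTyped Op.dif s (differentiationGraph G)).vars =
      ((differentiationGraph G).vars ∪ ((differentiationGraph G).vars.biUnion fun v =>
        (Finset.Icc 1 (if v ∈ s.colorV then 1 else 0)).image fun p => LVar.up p v)) ∪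
      (differentiationGraph (updateFull Op.dif s G)).edges.image Prod.fst := by
    rw [hedges]
    rfl
  rw [h1]
  ext ⟨i, k⟩
  have h2 : (updateFull Op.dif s G).vars =
      (G.vars ∪ (G.vars.biUnion fun v =>
        (Finset.Icc 1 (classColor Op.dif s.colorV v)).image fun p => VarName.up Op.dif p v)) ∪
      (updateFull Op.dif s G).edges.image Prod.fst := rfl
  simp only [differentiationGraph, deleteDelayed, h2, Finset.mem_image, Finset.mem_filter,
    Finset.mem_union, Finset.mem_biUnion, Finset.mem_Icc, classColor]
  constructor
  · rintro ⟨v, ⟨(hv | ⟨w, hw, p, ⟨hp1, hp2⟩, rfl⟩) | ⟨e, he, rfl⟩, h0⟩, h⟩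
    · exact Or.inl (Or.inl ⟨v, ⟨hv, h0⟩, h⟩)
    · have h0' : 0 ≤ w.shift := h0
      simp only [h0', true_and] at hp2
      exact Or.inl (Or.inr ⟨_, ⟨w, ⟨hw, h0⟩, rfl⟩, p, ⟨hp1, hp2⟩, by
        rw [← h]; simp [LVar.up, VarName.up]⟩)
    · exact Or.inr ⟨_, ⟨e, ⟨he, h0⟩, rfl⟩, h⟩
  · rintro ((⟨v, ⟨hv, h0⟩, h⟩ | ⟨_, ⟨w, ⟨hw, h0⟩, rfl⟩, p, ⟨hp1, hp2⟩, h⟩) |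
      ⟨_, ⟨e, ⟨he, h0⟩, rfl⟩, h⟩)
    · exact ⟨v, ⟨Or.inl (Or.inl hv), h0⟩, h⟩
    · refine ⟨_, ⟨Or.inl (Or.inr ⟨w, hw, p, ⟨hp1, ?_⟩, rfl⟩), h0⟩, by
        rw [← h]; simp [LVar.up, VarName.up]⟩
      simpa only [h0, true_and] using hp2
    · exact ⟨_, ⟨Or.inr ⟨e, he, rfl⟩, h0⟩, h⟩

/-- Neither the variables nor the equations of `G` are shifted forward. -/
structure IsUnshifted (G : BGraph VarName EqLabel) : Prop where
  vars : ∀ v ∈ G.vars, v.shift ≤ 0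
  edges : ∀ e ∈ G.edges, e.1.shift ≤ 0
  label : ∀ j < G.M, (G.label j).shift = 0

theorem IsUnshifted.updateFull {G : BGraph VarName EqLabel} (hG : IsUnshifted G)
    (s : SearchState) : IsUnshifted (updateFull Op.dif s G) := by
  have hedges : ∀ e ∈ (Pantelides.updateFull Op.dif s G).edges, e.1.shift ≤ 0 := by
    intro e he
    simp only [Pantelides.updateFull, updateGraph, Finset.mem_image, Finset.mem_union,
      Finset.mem_biUnion] at he
    rcases he with he | ⟨f, hf, p, -, rfl⟩
    · exact hG.edges e he
    · exact hG.edges f hf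
  refine ⟨fun v hv => ?_, hedges, hG.label⟩
  rcases Finset.mem_union.1 hv with hv | hv
  · simp only [Finset.mem_image, Finset.mem_union, Finset.mem_biUnion] at hv
    rcases hv with hv | ⟨w, hw, p, -, rfl⟩
    · exact hG.vars v hv
    · exact hG.vars w hw
  · obtain ⟨e, he, rfl⟩ := Finset.mem_image.1 hv
    exact hedges e he

/-- If nothing is shifted, then deleting the delayed variables yields the differentiation graph. -/
theorem IsUnshifted.exists_iso {G : BGraph VarName EqLabel} (hG : IsUnshifted G) :
    ∃ φ : (deleteDelayed G).Iso (differentiationGraph G),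
      (∀ j, (φ.onEq j).1 = j.1) ∧
      (∀ v, v.1.shift = 0 ∧ (φ.onVar v).1 = (v.1.idx, (v.1.der : ℤ))) := by
  have h0 : ∀ v ∈ (deleteDelayed G).vars, v.shift = 0 := fun v hv =>
    le_antisymm (hG.vars v (Finset.mem_filter.1 hv).1) (Finset.mem_filter.1 hv).2
  have hinj : ∀ v w : VarName, v.shift = 0 → w.shift = 0 →
      ((v.idx, (v.der : ℤ)) : LVar) = (w.idx, (w.der : ℤ)) → v = w := by
    rintro ⟨i, p, k⟩ ⟨i', p', k'⟩ h h' he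
    simp_all
  let f : {v // v ∈ (deleteDelayed G).vars} → {v // v ∈ (differentiationGraph G).vars} :=
    fun v => ⟨(v.1.idx, (v.1.der : ℤ)), Finset.mem_image_of_mem _ v.2⟩
  have hf : Function.Bijective f := by
    refine ⟨fun v w h => ?_, fun v => ?_⟩
    · exact Subtype.ext (hinj v.1 w.1 (h0 v.1 v.2) (h0 w.1 w.2) (congrArg Subtype.val h))
    · obtain ⟨w, hw, h⟩ := Finset.mem_image.1 v.2
      exact ⟨⟨w, hw⟩, Subtype.ext h⟩
  refine ⟨⟨Equiv.refl _, Equiv.ofBijective f hf, fun v j => ?_⟩, fun _ => rfl,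
    fun v => ⟨h0 v.1 v.2, rfl⟩⟩
  constructor
  · exact fun h => Finset.mem_image.2 ⟨_, h, rfl⟩
  · intro h
    obtain ⟨e, he, h⟩ := Finset.mem_image.1 h
    have h1 : ((e.1.idx, (e.1.der : ℤ)) : LVar) = (v.1.idx, (v.1.der : ℤ)) :=
      congrArg Prod.fst h
    have h2 : e.2 = j.1 := congrArg Prod.snd h
    have h3 : e.1.shift = 0 := le_antisymm (hG.edges e (Finset.mem_filter.1 he).1)
      (Finset.mem_filter.1 he).2
    have h4 := hinj _ _ h3 (h0 v.1 v.2) h1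
    rw [← h2, ← h4]
    exact he

/-! ## The loops of the algorithms -/

variable {M n : ℕ} {E : Finset (LVar × ℕ)} {σ : ℕ → Finset LVar → List LVar}

/-- Induction on the room `d` left below `B + M`. The bound `N₀`, the matching and the levels are
chosen before the full graph `G`, which is carried along without influencing the searches. -/
theorem repeat_spec (hE : IsNonsingularSystem M E) (hσ : IsEnumeration σ) {r : ℕ} (hr : r < M)
    (B d : ℕ) (ℓ : ℕ → ℕ) (a : LVar → Option ℕ) (hd : B + M ≤ ℓ r + d)
    (ha : IsMatching (restrictHighest (levelGraph M n E ℓ)) a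
      ↑(restrictHighest (levelGraph M n E ℓ)).vars {k | k < r})
    (hB : ∀ v ∈ (restrictHighest (levelGraph M n E ℓ)).vars, a v = none → v.2 ≤ B) :
    ∃ N₀ a' ℓ', (∀ N ≥ N₀, daeRepeat σ r N a (levelGraph M n E ℓ) =
        some (a', levelGraph M n E ℓ')) ∧
      IsMatching (restrictHighest (levelGraph M n E ℓ')) a'
        ↑(restrictHighest (levelGraph M n E ℓ')).vars {k | k < r + 1} ∧
      (∀ c, IsSaturated M n E c → (∀ j, ℓ j ≤ c j) → ∀ j, ℓ' j ≤ c j) ∧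
      ∀ G, differentiationGraph G = levelGraph M n E ℓ → IsUnshifted G →
        ∃ G', differentiationGraph G' = levelGraph M n E ℓ' ∧ IsUnshifted G' ∧
          ∀ N ≥ N₀, typedRepeat σ Op.dif r N a (levelGraph M n E ℓ) G =
            some (a', levelGraph M n E ℓ', G') := by
  induction d generalizing ℓ a with
  | zero => exact absurd (level_lt hE hr ha hB) (by omega)
  | succ d ih =>
    obtain ⟨N₁, ⟨b, s⟩, hp, ht, hf⟩ := augmentPath_spec hσ ha
    rcases b with _ | _
    · obtain ⟨hs, hb⟩ := hf rfl
      obtain ⟨as, CV, C⟩ := s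
      obtain rfl : as = a := hs
      dsimp only at hb
      obtain ⟨N₂, a', ℓ', h1, h2, h3, h4⟩ := ih (raiseLevel ℓ C) (raiseAssign as CV)
        -- The root `r` is itself coloured, so its level rises and `d` decreases.
        (by rw [raiseLevel, if_pos hb.root]; omega) (ha.raise hE hb) (exposed_le_raise hE ha hb hB)
      refine ⟨max N₁ N₂ + 1, a', ℓ', fun N hN => ?_, h2,
        fun c hc hle => h3 c hc (hb.raiseLevel_le hE hr ha hc hle), fun G hG hG0 => ?_⟩
      · obtain ⟨N, rfl⟩ : ∃ m, N = m + 1 := ⟨N - 1, by omega⟩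
        simp only [daeRepeat, hp N (by omega), Option.bind_some, Bool.false_eq_true, if_false]
        rw [daeUpdate_levelGraph hE ha hb]
        exact h1 N (by omega)
      · obtain ⟨G', h5, h6, h7⟩ := h4 (updateFull Op.dif ⟨as, CV, C⟩ G)
          (by rw [differentiationGraph_updateFull, hG, updateTyped_levelGraph hE ha hb])
          (hG0.updateFull _)
        refine ⟨G', h5, h6, fun N hN => ?_⟩
        obtain ⟨N, rfl⟩ : ∃ m, N = m + 1 := ⟨N - 1, by omega⟩
        simp only [typedRepeat, hp N (by omega), Option.bind_some, Bool.false_eq_true, if_false,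
          fullStep]
        rw [updateTyped_levelGraph hE ha hb]
        exact h7 N (by omega)
    · refine ⟨N₁ + 1, s.assign, ℓ, fun N hN => ?_, ht rfl, fun c _ h => h,
        fun G hG hG0 => ⟨G, hG, hG0, fun N hN => ?_⟩⟩
      · obtain ⟨N, rfl⟩ : ∃ m, N = m + 1 := ⟨N - 1, by omega⟩
        simp [daeRepeat, hp N (by omega)]
      · obtain ⟨N, rfl⟩ : ∃ m, N = m + 1 := ⟨N - 1, by omega⟩
        simp [typedRepeat, hp N (by omega)]

theorem foldlM_spec (hE : IsNonsingularSystem M E) (hσ : IsEnumeration σ) (r : ℕ) (hr : r ≤ M) :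
    ∃ N₀ a ℓ, (∀ N ≥ N₀, (List.range r).foldlM (fun st r => daeRepeat σ r N st.1 st.2)
        ((fun _ => none : LVar → Option ℕ), levelGraph M n E 0) =
          some (a, levelGraph M n E ℓ)) ∧
      IsMatching (restrictHighest (levelGraph M n E ℓ)) a
        ↑(restrictHighest (levelGraph M n E ℓ)).vars {k | k < r} ∧
      (∀ c, IsSaturated M n E c → ∀ j, ℓ j ≤ c j) ∧
      ∀ G, differentiationGraph G = levelGraph M n E 0 → IsUnshifted G →
        ∃ G', differentiationGraph G' = levelGraph M n E ℓ ∧ IsUnshifted G' ∧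
          ∀ N ≥ N₀, (List.range r).foldlM
            (fun st r => typedRepeat σ Op.dif r N st.1 st.2.1 st.2.2)
            ((fun _ => none : LVar → Option ℕ), levelGraph M n E 0, G) =
              some (a, levelGraph M n E ℓ, G') := by
  induction r with
  | zero =>
    exact ⟨0, fun _ => none, 0, fun _ _ => rfl, ⟨by simp, by simp, by simp, by simp⟩,
      fun c _ j => Nat.zero_le _, fun G hG hG0 => ⟨G, hG, hG0, fun _ _ => rfl⟩⟩
  | succ r ih =>
    obtain ⟨N₁, a, ℓ, h1, h2, h3, h4⟩ := ih (by omega)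
    -- For each new equation the bound is taken afresh, as the largest order present when its
    -- searches begin.
    set B := (restrictHighest (levelGraph M n E ℓ)).vars.sup fun v => v.2.toNat
    obtain ⟨N₂, a', ℓ', h5, h6, h7, h8⟩ := repeat_spec hE hσ (n := n) (r := r) (by omega) B (B + M)
      ℓ a (by omega) h2 fun v hv _ => by
        have : v.2.toNat ≤ B := Finset.le_sup (f := fun v : LVar => v.2.toNat) hv
        omega
    refine ⟨max N₁ N₂, a', ℓ', fun N hN => ?_, h6, fun c hc => h7 c hc (h3 c hc),
      fun G hG hG0 => ?_⟩
    · rw [List.range_succ, List.foldlM_append, h1 N (by omega)]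
      simp [h5 N (by omega)]
    · obtain ⟨G₁, hG₁, hG₁0, hrun⟩ := h4 G hG hG0
      obtain ⟨G₂, hG₂, hG₂0, hrun'⟩ := h8 G₁ hG₁ hG₁0
      refine ⟨G₂, hG₂, hG₂0, fun N hN => ?_⟩
      rw [List.range_succ, List.foldlM_append, hrun N (by omega)]
      simp [hrun' N (by omega)]

/-- Both algorithms, with possibly different orders of the searches, arrive at the same levels. -/
theorem differentiation_spec (hE : IsNonsingularSystem M E) {σ' : ℕ → Finset LVar → List LVar}
    (hσ : IsEnumeration σ) (hσ' : IsEnumeration σ') {G : BGraph VarName EqLabel}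
    (hG : differentiationGraph G = levelGraph M n E 0) (hG0 : IsUnshifted G) :
    ∃ G', IsUnshifted G' ∧ (differentiationGraph G').M = M ∧
      (∃ N₀, ∀ N ≥ N₀, pantelidesTyped σ N Op.dif (differentiationGraph G) G = some G') ∧
      DAETerminatesWith σ' (levelGraph M n E 0) (differentiationGraph G') := by
  obtain ⟨N₁, a, ℓ, -, h2, h3, h4⟩ := foldlM_spec (n := n) hE hσ M le_rfl
  obtain ⟨N₂, a', ℓ', h5, h6, h7, -⟩ := foldlM_spec (n := n) hE hσ' M le_rfl
  -- Both final levels are saturated and lie below all saturated levels.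
  obtain rfl : ℓ = ℓ' := funext fun j => le_antisymm (h3 ℓ' ⟨a', h6⟩ j) (h7 ℓ ⟨a, h2⟩ j)
  obtain ⟨G', hG', hG'0, hrun⟩ := h4 G hG hG0
  refine ⟨G', hG'0, by rw [hG']; rfl, ⟨N₁, fun N hN => ?_⟩, N₂, ?_⟩
  · have := hrun N hN
    rw [pantelidesTyped, hG]
    exact congrArg (Option.map fun st => st.2.2) this
  · rw [hG']
    exact congrArg (Option.map Prod.snd) (h5 N₂ le_rfl)

/-! ## The graphs of the equation -/

theorem DDAE.of_mem_appearing {D : DDAE M n} {j : Fin M} {v : VarName} (hv : v ∈ D.appearing j) :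
    v.der ≤ 1 ∧ v.shift ≤ 0 := by
  simp only [DDAE.appearing, Finset.mem_union, Finset.mem_image] at hv
  rcases hv with (⟨i, -, rfl⟩ | ⟨i, -, rfl⟩) | ⟨i, -, rfl⟩ <;> simp

theorem DDAE.mem_graph_edges {D : DDAE M n} {v : VarName} {j : ℕ} :
    (v, j) ∈ D.graph.edges ↔ ∃ j' : Fin M, (j' : ℕ) = j ∧ v ∈ D.appearing j' := by
  simp only [DDAE.graph, Finset.mem_biUnion, Finset.mem_univ, true_and, Finset.mem_image,
    Prod.mk.injEq]
  constructor
  · rintro ⟨j', v, hv, rfl, rfl⟩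
    exact ⟨j', rfl, hv⟩
  · rintro ⟨j', rfl, hv⟩
    exact ⟨j', v, hv, rfl, rfl⟩

theorem DDAE.mem_withParameter_edges {D : DDAE M n} {lam : ℝ → Fin n → ℝ} {v : LVar} {j : ℕ} :
    (v, j) ∈ (D.withParameter lam).graph.edges ↔
      ∃ j' : Fin M, (j' : ℕ) = j ∧ ∃ w ∈ D.appearing j', w.shift = 0 ∧ (w.idx, (w.der : ℤ)) = v := by
  simp only [DAE.graph, DDAE.withParameter, DDAE.appearing, Finset.mem_biUnion, Finset.mem_univ,
    true_and, Finset.mem_union, Finset.mem_image, Prod.mk.injEq]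
  refine exists_congr fun j' => ?_
  constructor
  · rintro (⟨i, hi, rfl, rfl⟩ | ⟨i, hi, rfl, rfl⟩)
    · exact ⟨rfl, ⟨i, 0, 0⟩, Or.inl (Or.inl ⟨i, hi, rfl⟩), rfl, rfl⟩
    · exact ⟨rfl, ⟨i, 1, 0⟩, Or.inl (Or.inr ⟨i, hi, rfl⟩), rfl, rfl⟩
  · rintro ⟨rfl, w, (⟨i, hi, rfl⟩ | ⟨i, hi, rfl⟩) | ⟨i, hi, rfl⟩, h0, rfl⟩
    · exact Or.inl ⟨i, hi, rfl, rfl⟩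
    · exact Or.inr ⟨i, hi, rfl, rfl⟩
    · simp at h0

theorem DDAE.withParameter_graph (D : DDAE M n) (lam : ℝ → Fin n → ℝ) :
    (D.withParameter lam).graph = levelGraph M n (D.withParameter lam).graph.edges 0 := by
  have hedges : (D.withParameter lam).graph.edges =
      (levelGraph M n (D.withParameter lam).graph.edges 0).edges := by
    ext ⟨v, j⟩
    rw [mem_levelGraph_edges]
    constructor
    · exact fun h => ⟨v.2, h, le_rfl, by simp⟩
    · rintro ⟨k, h, h1, h2⟩
      have : v.2 = k := by simp at h2; omega
      rwa [← this] at h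
  refine BGraph.ext_of rfl rfl rfl ?_ hedges
  ext v
  rw [mem_levelGraph_vars, ← hedges]
  simp only [DAE.graph, Finset.mem_biUnion, Finset.mem_univ, true_and, Finset.mem_union,
    Finset.mem_image, Prod.mk.injEq]
  constructor
  · rintro ⟨j, ⟨i, hi, rfl⟩ | ⟨i, hi, rfl⟩⟩
    · exact ⟨j, j, Or.inl ⟨i, hi, rfl, rfl⟩⟩
    · exact ⟨j, j, Or.inr ⟨i, hi, rfl, rfl⟩⟩
  · rintro ⟨-, j, ⟨i, hi, rfl, -⟩ | ⟨i, hi, rfl, -⟩⟩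
    · exact ⟨j, Or.inl ⟨i, hi, rfl⟩⟩
    · exact ⟨j, Or.inr ⟨i, hi, rfl⟩⟩

/-- The component index is constant on classes and separates them, which turns the count of classes
into a count of components. -/
theorem numClasses_REqual_le (A : Finset VarName) :
    numClasses A REqual ≤ (A.image VarName.idx).card := by
  let f : Quotient (REqual.comap (Subtype.val : {v : VarName // v ∈ A} → VarName)) →
      {i // i ∈ A.image VarName.idx} :=
    Quotient.lift (fun v => ⟨v.1.idx, Finset.mem_image_of_mem _ v.2⟩) (by
      rintro ⟨v, hv⟩ ⟨w, hw⟩ ⟨i, p, q, k, l, h1, h2⟩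
      dsimp only at h1 h2
      subst h1 h2
      rfl)
  have hf : Function.Injective f := by
    intro x y
    induction x using Quotient.inductionOn with | _ v
    induction y using Quotient.inductionOn with | _ w
    intro h
    have h' : v.1.idx = w.1.idx := congrArg Subtype.val h
    refine Quotient.sound ⟨v.1.idx, v.1.der, w.1.der, v.1.shift, w.1.shift, rfl, ?_⟩
    rw [h']
  have := Nat.card_le_card_of_injective f hf
  rwa [Nat.card_eq_fintype_card (α := {i // i ∈ A.image VarName.idx}), Fintype.card_coe] at this

theorem DDAE.isNonsingularSystem {D : DDAE M n}
    (hD : ¬ StructurallySingular D.appearing D.nonDelayedVariables REqual)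
    (lam : ℝ → Fin n → ℝ) : IsNonsingularSystem M (D.withParameter lam).graph.edges := by
  refine ⟨?_, ?_, fun S hS => ?_⟩
  · rintro ⟨v, j⟩ he
    obtain ⟨j', rfl, w, hw, -, rfl⟩ := D.mem_withParameter_edges.1 he
    have := (D.of_mem_appearing hw).1
    dsimp only
    omega
  · rintro ⟨v, j⟩ he
    obtain ⟨j', rfl, -⟩ := D.mem_withParameter_edges.1 he
    exact j'.2
  · set S' : Finset (Fin M) := Finset.univ.filter fun j => (j : ℕ) ∈ S with hS'
    have hcard : S.card = S'.card := by
      rw [← Finset.card_map Fin.valEmbedding]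
      congr 1
      ext j
      simp only [hS', Finset.mem_map, Finset.mem_filter, Finset.mem_univ, true_and,
        Fin.valEmbedding_apply]
      exact ⟨fun h => ⟨⟨j, Finset.mem_range.1 (hS h)⟩, h, rfl⟩, by rintro ⟨i, hi, rfl⟩; exact hi⟩
    have h1 : S'.card ≤ numClasses (D.nonDelayedVariables ∩ S'.biUnion D.appearing) REqual :=
      not_lt.1 fun h => hD ⟨S', h⟩
    rw [hcard]
    refine h1.trans ((numClasses_REqual_le _).trans (Finset.card_le_card ?_))
    intro i hi
    obtain ⟨v, hv, rfl⟩ := Finset.mem_image.1 hi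
    obtain ⟨hv1, hv2⟩ := Finset.mem_inter.1 hv
    obtain ⟨j, hj, hvj⟩ := Finset.mem_biUnion.1 hv2
    refine Finset.mem_image.2 ⟨((v.idx, (v.der : ℤ)), (j : ℕ)), Finset.mem_filter.2 ⟨?_, ?_⟩, rfl⟩
    · exact D.mem_withParameter_edges.2 ⟨j, rfl, v, hvj, (Finset.mem_filter.1 hv1).2, rfl⟩
    · exact (Finset.mem_filter.1 hj).2

/-- No component needs a new name. The label beyond `G.M` comes from the default pair `(0, 0)` for
the empty list and belongs to no equation. -/
theorem trimmedLinearization_of_der_le_one {G : BGraph VarName EqLabel}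
    (hG : ∀ e ∈ G.edges, e.1.der ≤ 1) :
    trimmedLinearization G =
      { M := G.M
        n := G.n
        label := fun j => if j < G.M then G.label j else ⟨0, maxShift G 0 0⟩
        vars := G.edges.image Prod.fst
        edges := G.edges } := by
  have hq : ∀ i, maxOrder G i ≤ 1 := fun i =>
    Finset.sup_le fun e he => hG e (Finset.mem_filter.1 he).1
  have hN : newPairs G = [] := by
    simp only [newPairs, List.flatMap_eq_nil_iff, List.map_eq_nil_iff, List.range_eq_nil]
    intro i _
    have := hq i
    omega
  have hren : ∀ v, renameVar G v = v := by
    intro v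
    have := hq v.idx
    simp only [renameVar]
    rw [if_neg (by omega), if_neg (by omega)]
  simp [trimmedLinearization, hN, hren]

theorem DDAE.differentiationGraph_trimmedLinearization (D : DDAE M n) (lam : ℝ → Fin n → ℝ) :
    differentiationGraph (trimmedLinearization D.graph) = (D.withParameter lam).graph ∧
      IsUnshifted (trimmedLinearization D.graph) := by
  have hder : ∀ e ∈ D.graph.edges, e.1.der ≤ 1 := by
    rintro ⟨v, j⟩ he
    obtain ⟨j', -, hv⟩ := D.mem_graph_edges.1 he
    exact (D.of_mem_appearing hv).1
  have hshift : ∀ e ∈ D.graph.edges, e.1.shift ≤ 0 := by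
    rintro ⟨v, j⟩ he
    obtain ⟨j', -, hv⟩ := D.mem_graph_edges.1 he
    exact (D.of_mem_appearing hv).2
  rw [trimmedLinearization_of_der_le_one hder]
  refine ⟨?_, fun v hv => ?_, hshift, fun j hj => ?_⟩
  · have hedges : ∀ v j, (v, j) ∈ (D.withParameter lam).graph.edges ↔
        ∃ w, (w, j) ∈ D.graph.edges ∧ 0 ≤ w.shift ∧ (w.idx, (w.der : ℤ)) = v := by
      intro v j
      rw [D.mem_withParameter_edges]
      constructor
      · rintro ⟨j', hj, w, hw, h0, h⟩
        exact ⟨w, D.mem_graph_edges.2 ⟨j', hj, hw⟩, h0.ge, h⟩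
      · rintro ⟨w, hw, h0, h⟩
        obtain ⟨j', hj, hw'⟩ := D.mem_graph_edges.1 hw
        exact ⟨j', hj, w, hw', le_antisymm (hshift _ hw) h0, h⟩
    refine BGraph.ext_of rfl rfl ?_ ?_ ?_
    · funext j
      change (if j < D.graph.M then D.graph.label j else ⟨0, maxShift D.graph 0 0⟩).der = 0
      split <;> rfl
    · ext v
      rw [D.withParameter_graph lam, mem_levelGraph_vars]
      have h1 := congrArg BGraph.edges (D.withParameter_graph lam)
      simp only [← h1, hedges]
      simp only [differentiationGraph, deleteDelayed, Finset.mem_image, Finset.mem_filter]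
      constructor
      · rintro ⟨_, ⟨⟨⟨w, j⟩, he, rfl⟩, h0⟩, h⟩
        exact ⟨j, w, he, h0, h⟩
      · rintro ⟨j, w, he, h0, h⟩
        exact ⟨w, ⟨⟨(w, j), he, rfl⟩, h0⟩, h⟩
    · ext ⟨v, j⟩
      rw [hedges]
      simp only [differentiationGraph, deleteDelayed, Finset.mem_image, Finset.mem_filter]
      constructor
      · rintro ⟨⟨w, j'⟩, ⟨he, h0⟩, h⟩
        simp only [Prod.mk.injEq] at h
        obtain ⟨h, rfl⟩ := h
        exact ⟨w, he, h0, Prod.ext (congrArg Prod.fst h) (congrArg Prod.snd h)⟩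
      · rintro ⟨w, he, h0, h⟩
        exact ⟨(w, j), ⟨he, h0⟩, by rw [← h]⟩
  · obtain ⟨e, he, rfl⟩ := Finset.mem_image.1 hv
    exact hshift e he
  · simp only [if_pos hj]
    rfl

/-! ## The shifting step -/

/-- All non-delayed variables of a component are merged into one highest vertex `(i, 0)`, so a
blocked search contradicts Hall's condition for `C` directly. -/
theorem DDAE.not_isBlocked_shiftingGraph {D : DDAE M n}
    (hD : ¬ StructurallySingular D.appearing D.nonDelayedVariables REqual) {r : ℕ} (hr : r < M)
    {a : LVar → Option ℕ} {CV : Finset LVar} {C : Finset ℕ}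
    (ha : IsMatching (restrictHighest (shiftingGraph D.graph)) a
      ↑(restrictHighest (shiftingGraph D.graph)).vars {k | k < r}) :
    ¬ IsBlocked (restrictHighest (shiftingGraph D.graph)) a r CV C := by
  intro hb
  have hvars : ∀ v ∈ (shiftingGraph D.graph).vars, v.2 ≤ 0 := by
    intro v hv
    obtain ⟨w, hw, rfl⟩ := Finset.mem_image.1 hv
    obtain ⟨j, -, hj⟩ := Finset.mem_biUnion.1 hw
    exact (D.of_mem_appearing hj).2
  have hC : C ⊆ Finset.range M := fun k hk => Finset.mem_range.2 <|
    hb.reach (· < M) hr (fun k v k' _ hv hk' => by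
      have h := (mem_restrictHighest_edges.1 (ha.edge v (mem_neighbours.1 hv).1 k' hk')).1
      obtain ⟨⟨w, j⟩, he, h⟩ := Finset.mem_image.1 h
      obtain ⟨j', rfl, -⟩ := D.mem_graph_edges.1 he
      simp only [Prod.mk.injEq] at h
      rw [← h.2]
      exact j'.2) k hk
  have hcard : C.card ≤ (C.erase r).card := by
    -- Any parameter would do, since the edges do not depend on it.
    refine (D.isNonsingularSystem hD fun _ _ => 0).card_le hC ha.inj ?_
    rintro ⟨v, j⟩ he hj
    obtain ⟨j', rfl, w, hw, h0, rfl⟩ := D.mem_withParameter_edges.1 he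
    have hwG : w ∈ D.graph.vars := Finset.mem_biUnion.2 ⟨j', Finset.mem_univ _, hw⟩
    have hv : ((w.idx, 0) : LVar) ∈ (shiftingGraph D.graph).vars :=
      Finset.mem_image.2 ⟨w, hwG, by rw [h0]⟩
    have hh : IsHighest (shiftingGraph D.graph).vars (w.idx, 0) :=
      ⟨le_rfl, fun u hu _ => hvars u hu⟩
    have hedge : (((w.idx, 0) : LVar), (j' : ℕ)) ∈ (shiftingGraph D.graph).edges :=
      Finset.mem_image.2 ⟨(w, j'), D.mem_graph_edges.2 ⟨j', rfl, hw⟩, by rw [h0]⟩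
    obtain ⟨hvH, k, hk, hak⟩ := hb.var _ (hb.nbr j' hj _ (mem_neighbours.2
      ⟨mem_restrictHighest_vars.2 ⟨hv, hh⟩, mem_restrictHighest_edges.2 ⟨hedge, hh⟩⟩))
    have hkr : k < r := ha.mem _ hvH k hak
    exact ⟨_, hvH, rfl, k, Finset.mem_erase.2 ⟨hkr.ne, hk⟩, hak⟩
  have := Finset.card_erase_add_one hb.root
  omega

/-- As every search succeeds at once, neither an update nor any of the integer programs comes into
play. -/
theorem DDAE.shiftingStep {D : DDAE M n}
    (hD : ¬ StructurallySingular D.appearing D.nonDelayedVariables REqual)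
    (hσ : IsEnumeration σ) :
    ∃ N₀, ∀ N ≥ N₀,
      pantelidesTyped σ N Op.shift (shiftingGraph D.graph) D.graph = some D.graph := by
  have key : ∀ r ≤ M, ∃ N₀ a, IsMatching (restrictHighest (shiftingGraph D.graph)) a
      ↑(restrictHighest (shiftingGraph D.graph)).vars {k | k < r} ∧
      ∀ N ≥ N₀, (List.range r).foldlM (fun st r => typedRepeat σ Op.shift r N st.1 st.2.1 st.2.2)
        ((fun _ => none : LVar → Option ℕ), shiftingGraph D.graph, D.graph) =
          some (a, shiftingGraph D.graph, D.graph) := by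
    intro r
    induction r with
    | zero =>
      exact fun _ => ⟨0, fun _ => none, ⟨by simp, by simp, by simp, by simp⟩, fun _ _ => rfl⟩
    | succ r ih =>
      intro hr
      obtain ⟨N₁, a, ha, hrun⟩ := ih (by omega)
      obtain ⟨N₂, ⟨b, s⟩, hp, ht, hf⟩ := augmentPath_spec hσ ha
      rcases b with _ | _
      · exact absurd (hf rfl).2 (D.not_isBlocked_shiftingGraph hD hr ha)
      · refine ⟨max N₁ N₂ + 1, s.assign, ht rfl, fun N hN => ?_⟩
        rw [List.range_succ, List.foldlM_append, hrun N (by omega)]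
        obtain ⟨N, rfl⟩ : ∃ m, N = m + 1 := ⟨N - 1, by omega⟩
        simp [typedRepeat, hp N (by omega)]
  obtain ⟨N₀, a, -, h⟩ := key M le_rfl
  exact ⟨N₀, fun N hN => congrArg (Option.map fun st :
    (LVar → Option ℕ) × LGraph × BGraph VarName EqLabel => st.2.2) (h N hN)⟩

end Pantelides

theorem mainTheorem3 {M n : ℕ} (D : Pantelides.DDAE M n)
    (hD : ¬ Pantelides.StructurallySingular D.appearing D.nonDelayedVariables Pantelides.REqual)
    (lam : ℝ → Fin n → ℝ)
    (σ σ' : ℕ → Finset Pantelides.LVar → List Pantelides.LVar)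
    (hσ : Pantelides.IsEnumeration σ) (hσ' : Pantelides.IsEnumeration σ') :
    ∃ (G : Pantelides.BGraph Pantelides.VarName Pantelides.EqLabel) (H : Pantelides.LGraph),
      Pantelides.DDAETerminatesWith σ D.graph G ∧
      G.M = M ∧ (∀ j < M, (G.label j).shift = 0) ∧
      Pantelides.DAETerminatesWith σ' (D.withParameter lam).graph H ∧
      ∃ φ : (Pantelides.deleteDelayed G).Iso H,
        (∀ j, (φ.onEq j).1 = j.1 ∧ H.label j.1 = (G.label j.1).der) ∧
        (∀ v, v.1.shift = 0 ∧ (φ.onVar v).1 = (v.1.idx, (v.1.der : ℤ))) := by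
  obtain ⟨N₁, hshift⟩ := D.shiftingStep hD hσ
  obtain ⟨hgraph, hunshifted⟩ := D.differentiationGraph_trimmedLinearization lam
  obtain ⟨G, hG, hM, ⟨N₂, hdif⟩, hdae⟩ := Pantelides.differentiation_spec
    (D.isNonsingularSystem hD lam) hσ hσ' (hgraph.trans (D.withParameter_graph lam)) hunshifted
  obtain ⟨φ, hφ, hφ'⟩ := hG.exists_iso
  have hGM : G.M = M := hM
  refine ⟨G, Pantelides.differentiationGraph G, ⟨max N₁ N₂, ?_⟩, hGM,
    fun j hj => hG.label j (hGM.symm ▸ hj), ?_, φ, fun j => ⟨hφ j, rfl⟩, hφ'⟩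
  · rw [Pantelides.pantelidesDDAE, hshift _ (le_max_left _ _), Option.bind_some]
    exact hdif _ (le_max_right _ _)
  · rw [D.withParameter_graph lam]
    exact hdae
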